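/- **Setting.** Let $p$ be a prime, $\omega=e^{2\pi i/p}$, and let $\mathcal H_p=\mathbb C^p$ have orthonormal basis $\{|x\rangle : x\in\mathbf F_p\}$, with $|\Psi_p\rangle=p^{-1/2}\sum_{x}|x\rangle|x\rangle\in\mathcal H_p\otimes\mathcal H_p$. On $\mathbf F_p^{2m}$ use the symplectic form $\langle(\vec a|\vec b),(\vec c|\vec d)\rangle=\vec a\cdot\vec d-\vec b\cdot\vec c$, with complement $\perp s$, and the symplectic weight $w_s(\vec a|\vec b)=|\{i:(a_i,b_i)\ne(0,0)\}|$. Put $(\vec a|\vec b)^\star=(\vec a|-\vec b)$, and let $X(\vec a)Z(\vec b)|\vec x\rangle=\omega^{\vec b\cdot\vec x}|\vec x+\vec a\rangle$. Let $D\subset\mathbf F_p^{2n}$ be a linear space that defines an $[[n,k,d;c]]_p$ entanglement-assisted code: $\dim D=n+c-k$, $2c=\dim D-\dim(D\cap D^{\perp s})$, and $d=\min\{w_s(v): v\in D^{\perp s}\setminus D\}$ (with $d=\infty$ if this set is empty). Let $C\subset C^{\perp s}\subset\mathbf F_p^{2(n+c)}$ be an $[[n+c,k]]_p$ stabilizer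 code, i.e. $\dim C=n+c-k$, whose puncturing at the last $c$ positions is $D$. Let $\vec h_1,\dots,\vec h_r$ be a basis of $C$ ($r=n+c-k$). Bob's observables are $g_i=\varphi_iX(\vec a)Z(\vec b)$ for $\vec h_i=(\vec a|\vec b)$, where the $\varphi_i\in\mathbb C$ are any phases with $g_i^p=1$; Alice's observables are $g_i^\star=\overline{\varphi_i}X(\vec a)Z(-\vec b)$, which belong to the basis $\vec h_i^\star$ of $C^\star$. Outcome $s_i\in\mathbf F_p$ means eigenvalue $\omega^{s_i}$, and $Q(s)$ is the joint eigenspace of the $g_i$ for the syndrome $s$. For each $s\in\mathbf F_p^r$ let $U_s:\mathcal H_p^{\otimes k}\otimes\mathcal H_p^{\otimes r}\to\mathcal H_p^{\otimes(n+c)}$ be any encoding operator of $Q(s)$: a unitary such that, for some ancilla basis state $|j_s\rangle$, $U_s(|i\rangle\otimes|j_s\rangle)\in Q(s)$ for all basis states $|i\rangle$ of $\mathcal H_p^{\otimes k}$. (A single unitary that sends different ancilla basis states to different $Q(s)$ is a special case.) Its entrywise complex conjugate $\overline{U_s}$ is an encoding operator for $C^\star$ and its syndrome $-s$. **Protocol.**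 Alice and Bob share $n$ noisy pairs and $c$ perfect pairs $|\Psi_p\rangle^{\otimes c}$. 1. Alice measures $g_1^\star,\dots,g_r^\star$ on her $n+c$ qudits and gets the syndrome $a$. 2. Bob measures $g_1,\dots,g_r$ on his $n+c$ qudits and gets the syndrome $b$. 3. Alice sends $a$ to Bob. 4. A decoder maps $a+b$ and the set $E$ of erased positions to a Pauli operator $X(\vec u)Z(\vec v)$ on $n+c$ qudits, and Bob applies its inverse. 5. Alice applies $\overline{U_{-a}}^{\,-1}$ and Bob applies $U_{-a}^{-1}$. 6. Both keep the $k$ information qudits and discard the other $n+c-k$. **Errors.** The $n$ noisy pairs contain erasures at $E$ and at most $t$ errors if their joint density operator has its range in the span, over all sets $T$ of at most $t$ positions, of the vectors that are arbitrary on the pairs at positions in $E\cup T$ and equal to $|\Psi_p\rangle$ at each other position. **Theorem.** There is a decoder, depending only on $C$ and its basis $\vec h_1,\dots,\vec h_r$, such that for all phases $\varphi_i$ and encoding operators $U_s$ as above and all integers $t,e\ge0$ with $2t+e<d$, the protocol corrects $t$ errors and $e$ erasures: whenever $|E|\le e$ and the noisy pairs contain erasures at $E$ and at most $t$ errors, the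 final state of the protocol is exactly $|\Psi_p\rangle^{\otimes k}$. It produces $k$ maximally entangled pairs and consumes $c$, so its net yield is $k-c$. -/

import Mathlib

open scoped Kronecker ComplexOrder

noncomputable section

namespace Breeding

/-! ### Symplectic geometry over `F_p` -/

/-- `F_p^{2|ι|}`: pairs `(a|b)` of vectors, one coordinate of each per qudit in `ι`. -/
abbrev Symp (p : ℕ) (ι : Type) : Type := (ι → ZMod p) × (ι → ZMod p)

/-- The symplectic inner product `⟨a, d⟩ - ⟨b, c⟩` of `(a|b)` and `(c|d)`. -/
def sympForm {p : ℕ} {ι : Type} [Fintype ι] (v w : Symp p ι) : ZMod p :=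
  v.1 ⬝ᵥ w.2 - v.2 ⬝ᵥ w.1

/-- The symplectic weight: the number of qudits `i` with `(a_i, b_i) ≠ (0, 0)`. -/
def sympWeight {p : ℕ} {ι : Type} [Fintype ι] (v : Symp p ι) : ℕ :=
  (Finset.univ.filter fun i => (v.1 i, v.2 i) ≠ (0, 0)).card

/-- The symplectic complement `C^{⊥s}`. -/
def sympCompl {p : ℕ} {ι : Type} [Fintype ι] (C : Submodule (ZMod p) (Symp p ι)) :
    Submodule (ZMod p) (Symp p ι) where
  carrier := {v | ∀ w ∈ C, sympForm w v = 0}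
  add_mem' := by
    intro v v' hv hv' w hw
    have h1 := hv w hw
    have h2 := hv' w hw
    simp only [sympForm] at h1 h2
    simp only [sympForm, Prod.fst_add, Prod.snd_add, dotProduct_add]
    linear_combination h1 + h2
  zero_mem' := by
    intro w _
    simp [sympForm]
  smul_mem' := by
    intro x v hv w hw
    have h1 := hv w hw
    simp only [sympForm] at h1
    simp only [sympForm, Prod.smul_fst, Prod.smul_snd, dotProduct_smul, smul_eq_mul]
    linear_combination x * h1

/-- The operation `(a|b)^⋆ = (a|-b)`. -/
def starVec {p : ℕ} {ι : Type} (v : Symp p ι) : Symp p ι := (v.1, -v.2)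

/-- `C` is (the linear space of) an `[[|ι|, k]]_p` stabilizer code. -/
def IsStabilizerCode {p : ℕ} {ι : Type} [Fintype ι] (C : Submodule (ZMod p) (Symp p ι))
    (k : ℕ) : Prop :=
  C ≤ sympCompl C ∧ Module.finrank (ZMod p) C + k = Fintype.card ι

/-- The minimum of the symplectic weight on `D^{⊥s} \ D` (`⊤` if that set is empty). -/
def minDistance {p : ℕ} {ι : Type} [Fintype ι] (D : Submodule (ZMod p) (Symp p ι)) : ℕ∞ :=
  ⨅ v ∈ {v : Symp p ι | v ∈ sympCompl D ∧ v ∉ D}, (sympWeight v : ℕ∞)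

/-- `D` is (the linear space of) an `[[n, k, d; c]]_p` entanglement-assisted code. -/
def IsEACode {p n : ℕ} (D : Submodule (ZMod p) (Symp p (Fin n))) (k : ℕ) (d : ℕ∞) (c : ℕ) :
    Prop :=
  Module.finrank (ZMod p) D + k = n + c ∧
  2 * c + Module.finrank (ZMod p) (D ⊓ sympCompl D : Submodule (ZMod p) (Symp p (Fin n))) =
    Module.finrank (ZMod p) D ∧
  minDistance D = d

/-- Puncturing: delete from all vectors of `C` the coordinates of the last `c` qudits. -/
def puncture {p n c : ℕ} (C : Submodule (ZMod p) (Symp p (Fin n ⊕ Fin c))) :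
    Submodule (ZMod p) (Symp p (Fin n)) :=
  C.map (LinearMap.prodMap (LinearMap.funLeft (ZMod p) (ZMod p) Sum.inl)
    (LinearMap.funLeft (ZMod p) (ZMod p) Sum.inl))

/-! ### Qudit registers, Pauli operators and syndrome measurements -/

/-- Labels of the computational basis of the register `(ℂ^p)^{⊗ι}`. -/
abbrev Reg (p : ℕ) (ι : Type) : Type := ι → ZMod p

/-- The generalized Pauli operator `X(a)Z(b) : |x⟩ ↦ ω^{⟨b, x⟩} |x + a⟩`, `ω = exp(2πi/p)`. -/
def pauli {p : ℕ} [NeZero p] {ι : Type} [Fintype ι] (v : Symp p ι) :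
    Matrix (Reg p ι) (Reg p ι) ℂ :=
  Matrix.of fun y x => if y = x + v.1 then ZMod.stdAddChar (v.2 ⬝ᵥ x) else 0

/-- For a unitary `g` with `g ^ p = 1`, the orthogonal projection onto the eigenspace of `g` of
eigenvalue `ω^s`. -/
def eigProj {p : ℕ} [NeZero p] {ι : Type} [Fintype ι] [DecidableEq ι]
    (g : Matrix (Reg p ι) (Reg p ι) ℂ) (s : ZMod p) : Matrix (Reg p ι) (Reg p ι) ℂ :=
  (p : ℂ)⁻¹ • ∑ j ∈ Finset.range p, ZMod.stdAddChar (-((j : ZMod p) * s)) • g ^ j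

/-- The operator by which a state changes when the observables `g 0, …, g (r - 1)` are measured
one after the other, with outcomes `s`. -/
def syndromeProj {p : ℕ} [NeZero p] {ι : Type} [Fintype ι] [DecidableEq ι] {r : ℕ}
    (g : Fin r → Matrix (Reg p ι) (Reg p ι) ℂ) (s : Fin r → ZMod p) :
    Matrix (Reg p ι) (Reg p ι) ℂ :=
  (List.ofFn fun i => eigProj (g i) (s i)).reverse.prod

/-- `ψ` lies in the joint eigenspace of syndrome `s` of the observables `g`. -/
def InCodeSpace {p : ℕ} [NeZero p] {ι : Type} [Fintype ι] [DecidableEq ι] {r : ℕ}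
    (g : Fin r → Matrix (Reg p ι) (Reg p ι) ℂ) (s : Fin r → ZMod p) (ψ : Reg p ι → ℂ) : Prop :=
  ∀ i, (g i).mulVec ψ = (ZMod.stdAddChar (s i) : ℂ) • ψ

/-- `U` is an encoding operator, from `k` information and `r` ancilla qudits, for the code of
syndrome `s`: a unitary that takes `|i⟩ ⊗ |j⟩` into the code, for some basis state `|j⟩` of the
ancilla and all `i`. -/
def IsEncoder {p : ℕ} [NeZero p] {ι : Type} [Fintype ι] [DecidableEq ι] {k r : ℕ}
    (g : Fin r → Matrix (Reg p ι) (Reg p ι) ℂ) (s : Fin r → ZMod p)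
    (U : Matrix (Reg p ι) (Reg p (Fin k) × Reg p (Fin r)) ℂ) : Prop :=
  U.conjTranspose * U = 1 ∧ U * U.conjTranspose = 1 ∧
  ∃ j : Reg p (Fin r), ∀ i : Reg p (Fin k), InCodeSpace g s fun x => U x (i, j)

/-- Bob's observables: `φ i X(a)Z(b)` for the `i`-th basis vector `(a|b)`. -/
def bobObservable {p : ℕ} [NeZero p] {ι : Type} [Fintype ι] {r : ℕ}
    (h : Fin r → Symp p ι) (φ : Fin r → ℂ) (i : Fin r) : Matrix (Reg p ι) (Reg p ι) ℂ :=
  φ i • pauli (h i)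

/-- Alice's observables: the same for `(a|b)^⋆`, with the conjugate phases. -/
def aliceObservable {p : ℕ} [NeZero p] {ι : Type} [Fintype ι] {r : ℕ}
    (h : Fin r → Symp p ι) (φ : Fin r → ℂ) (i : Fin r) : Matrix (Reg p ι) (Reg p ι) ℂ :=
  star (φ i) • pauli (starVec (h i))

/-! ### Shared states -/

/-- Operators on a register of pairs; the first component of an index is Alice's. -/
abbrev PairOp (p : ℕ) (ι : Type) : Type := Matrix (Reg p ι × Reg p ι) (Reg p ι × Reg p ι) ℂ

/-- The state vector `|Ψ_p⟩ = p^{-1/2} ∑ |i⟩|i⟩` of one pair. -/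
def bell (p : ℕ) (x y : ZMod p) : ℂ := if x = y then ((Real.sqrt p : ℝ) : ℂ)⁻¹ else 0

/-- The state vector `|Ψ_p⟩^{⊗ι}`. -/
def maxEnt (p : ℕ) (ι : Type) [Fintype ι] (u : Reg p ι × Reg p ι) : ℂ :=
  ∏ i, bell p (u.1 i) (u.2 i)

/-- The density operator of `|Ψ_p⟩^{⊗ι}`. -/
def maxEntOp (p : ℕ) (ι : Type) [Fintype ι] : PairOp p ι :=
  Matrix.vecMulVec (maxEnt p ι) (star (maxEnt p ι))

/-- The state vectors that are arbitrary on the pairs in `S` and `|Ψ_p⟩` on all other pairs. -/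
def noisyVectors (p : ℕ) {n : ℕ} (S : Finset (Fin n)) :
    Set (Reg p (Fin n) × Reg p (Fin n) → ℂ) :=
  {ψ | ∃ χ : Reg p S × Reg p S → ℂ, ∀ x y,
    ψ (x, y) = χ (fun i => x i, fun i => y i) * ∏ i ∈ Sᶜ, bell p (x i) (y i)}

/-- `σ` is a density operator of `n` pairs with erasures at the pairs in `E` and at most `t`
errors elsewhere; the positions of the errors may also be in superposition. -/
def IsNoisyState {p n : ℕ} [NeZero p] (E : Finset (Fin n)) (t : ℕ) (σ : PairOp p (Fin n)) :
    Prop :=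
  σ.PosSemidef ∧ σ.trace = 1 ∧
  ∀ w, σ.mulVec w ∈
    Submodule.span ℂ (⋃ T ∈ {T : Finset (Fin n) | T.card ≤ t}, noisyVectors p (E ∪ T))

/-- `σ ⊗ |Ψ_p⟩⟨Ψ_p|^{⊗c}`: the `n` noisy pairs together with `c` perfect ones. -/
def withPerfectPairs {p n : ℕ} (c : ℕ) (σ : PairOp p (Fin n)) : PairOp p (Fin n ⊕ Fin c) :=
  Matrix.of fun u v =>
    σ (fun i => u.1 (Sum.inl i), fun i => u.2 (Sum.inl i))
      (fun i => v.1 (Sum.inl i), fun i => v.2 (Sum.inl i)) *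
    maxEntOp p (Fin c) (fun i => u.1 (Sum.inr i), fun i => u.2 (Sum.inr i))
      (fun i => v.1 (Sum.inr i), fun i => v.2 (Sum.inr i))

/-! ### Distillation protocols with preshared entanglement -/

/-- A protocol that takes `n` noisy and `consumed` perfect pairs to `produced` pairs; `run E` is
its action on the shared density operator if the set of erased pairs is `E`. -/
structure Protocol (p n : ℕ) where
  consumed : ℕ
  produced : ℕ
  run : Finset (Fin n) → PairOp p (Fin n ⊕ Fin consumed) → PairOp p (Fin produced)

/-- The number of maximally entangled pairs produced minus the number consumed. -/
def Protocol.netYield {p n : ℕ} (P : Protocol p n) : ℤ := (P.produced : ℤ) - (P.consumed : ℤ)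

/-- The protocol turns every state with at most `t` errors and `e` erasures, together with the
preshared pairs, into exactly `|Ψ_p⟩^{⊗produced}`. -/
def Protocol.Corrects {p n : ℕ} [NeZero p] (P : Protocol p n) (t e : ℕ) : Prop :=
  ∀ (E : Finset (Fin n)) (σ : PairOp p (Fin n)), E.card ≤ e → IsNoisyState E t σ →
    P.run E (withPerfectPairs P.consumed σ) = maxEntOp p (Fin P.produced)

/-- Alice and Bob each discard their `r` ancilla qudits (partial trace). -/
def discardAncillas {p k r : ℕ} [NeZero p]
    (M : Matrix ((Reg p (Fin k) × Reg p (Fin r)) × (Reg p (Fin k) × Reg p (Fin r)))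
      ((Reg p (Fin k) × Reg p (Fin r)) × (Reg p (Fin k) × Reg p (Fin r))) ℂ) :
    PairOp p (Fin k) :=
  Matrix.of fun u v => ∑ j : Reg p (Fin r), ∑ j' : Reg p (Fin r),
    M ((u.1, j), (u.2, j')) ((v.1, j), (v.2, j'))

/-- Alice's operation on her `n + c` qudits when her syndrome is `a`: the measurement for `C^⋆`,
then the inverse of the encoder that is the complex conjugate of Bob's. -/
def aliceOp {p n c k r : ℕ} [NeZero p] (h : Fin r → Symp p (Fin n ⊕ Fin c)) (φ : Fin r → ℂ)
    (U : (Fin r → ZMod p) →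
      Matrix (Reg p (Fin n ⊕ Fin c)) (Reg p (Fin k) × Reg p (Fin r)) ℂ)
    (a : Fin r → ZMod p) :
    Matrix (Reg p (Fin k) × Reg p (Fin r)) (Reg p (Fin n ⊕ Fin c)) ℂ :=
  ((U (-a)).map star).conjTranspose * syndromeProj (aliceObservable h φ) a

/-- Bob's operation on his `n + c` qudits when the syndromes are `a` and `b`: the measurement
for `C`, then the inverse of the Pauli operator that the decoder finds from `a + b` and the set
`E` of erased pairs, then the inverse of his encoder. -/
def bobOp {p n c k r : ℕ} [NeZero p] (h : Fin r → Symp p (Fin n ⊕ Fin c)) (φ : Fin r → ℂ)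
    (U : (Fin r → ZMod p) →
      Matrix (Reg p (Fin n ⊕ Fin c)) (Reg p (Fin k) × Reg p (Fin r)) ℂ)
    (dec : Finset (Fin n) → (Fin r → ZMod p) → Symp p (Fin n ⊕ Fin c))
    (E : Finset (Fin n)) (a b : Fin r → ZMod p) :
    Matrix (Reg p (Fin k) × Reg p (Fin r)) (Reg p (Fin n ⊕ Fin c)) ℂ :=
  (U (-a)).conjTranspose * (pauli (dec E (a + b))).conjTranspose *
    syndromeProj (bobObservable h φ) b

/-- The breeding protocol, as a map of density operators: the sum over all outcomes `a`, `b` of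
the (unnormalized) final states. -/
def breedingProtocol {p n c k r : ℕ} [NeZero p] (h : Fin r → Symp p (Fin n ⊕ Fin c))
    (φ : Fin r → ℂ)
    (U : (Fin r → ZMod p) →
      Matrix (Reg p (Fin n ⊕ Fin c)) (Reg p (Fin k) × Reg p (Fin r)) ℂ)
    (dec : Finset (Fin n) → (Fin r → ZMod p) → Symp p (Fin n ⊕ Fin c)) :
    Protocol p n where
  consumed := c
  produced := k
  run := fun E ρ => ∑ a : Fin r → ZMod p, ∑ b : Fin r → ZMod p,
    discardAncillas
      ((aliceOp h φ U a ⊗ₖ bobOp h φ U dec E a b) * ρ *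
        (aliceOp h φ U a ⊗ₖ bobOp h φ U dec E a b).conjTranspose)

end Breeding

end

/-!
Vectorize: a matrix `F` stands for the state vector `∑ F y x |x⟩|y⟩`. The identity stands for a
multiple of the maximally entangled state, `F` for what remains after Bob applies `F` to his half,
and local operations `A ⊗ B` send `F` to `B F Aᵀ`.

*Errors.* Pauli operators span all operators on a set of qudits, so the range of a noisy state,
with the perfect pairs adjoined, is spanned by vectorized Pauli operators that act trivially on the
preshared qudits and have at most `t` nontrivial positions outside `E`
(`col_withPerfectPairs_mem_span`).

*Measurements.* Alice's observables are the entrywise conjugates of Bob's. Her outcome `a`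
therefore amounts to Bob's projecting onto the code space of syndrome `-a` before the error `P_v`
happens. As `P_v` shifts syndromes by that of `v`, Bob's outcome `b` has `a + b` equal to the
syndrome of `v`, or zero amplitude (`syndromeProj_mul_pauli_mul`).

*Decoding.* The decoder picks an error `u` on the noisy qudits with this syndrome and the fewest
positions outside `E`. Then `v - u` is symplectically orthogonal to `C`, vanishes on the preshared
qudits, and has weight at most `2t + |E| < d`. So its restriction lies in `D^⊥` and, by the
definition of `d`, in `D`, and counting dimensions shows that vectors of `D ∩ D^⊥`, padded by zeros,
lie in `C` (`padZero_mem_of_mem_inf`). Hence `P_u⁻¹ P_v` acts on the code space as a scalar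
(`exists_pauli_mul_syndromeProj`).

*Final state.* Whatever the error, what is left is a scalar times `U† Π U`, where `Π` projects onto
the code space of syndrome `-a`. The code space has dimension `p ^ k`, so this is `1 ⊗ |j⟩⟨j|`
(`exists_conjTranspose_mul_syndromeProj_mul`): a maximally entangled state of the information
qudits times a product state of the ancillas. Each pair of outcomes thus contributes a multiple of
the density operator of the maximally entangled state, and the multiples add up to one because the
protocol preserves the trace (`trace_run`).
-/

namespace Breeding

/-! ### Spectral projections of commuting observables -/

section Projections

variable {p : ℕ} [Fact p.Prime] {ι : Type} [Fintype ι] [DecidableEq ι]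

lemma stdAddChar_eq_one_iff (x : ZMod p) : (ZMod.stdAddChar x : ℂ) = 1 ↔ x = 0 := by
  rw [← AddChar.map_zero_eq_one (ZMod.stdAddChar (N := p))]
  exact ZMod.injective_stdAddChar.eq_iff

lemma star_stdAddChar (x : ZMod p) : star (ZMod.stdAddChar x : ℂ) = ZMod.stdAddChar (-x) :=
  (AddChar.map_neg_eq_conj _ x).symm

lemma stdAddChar_natCast_mul (j : ℕ) (x : ZMod p) :
    (ZMod.stdAddChar ((j : ZMod p) * x) : ℂ) = ZMod.stdAddChar x ^ j := by
  rw [← nsmul_eq_mul, AddChar.map_nsmul_eq_pow]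

lemma mul_eigProj {g : Matrix (Reg p ι) (Reg p ι) ℂ} (hg : g ^ p = 1) (s : ZMod p) :
    g * eigProj g s = (ZMod.stdAddChar s : ℂ) • eigProj g s := by
  let f : ℕ → Matrix (Reg p ι) (Reg p ι) ℂ := fun j =>
    ZMod.stdAddChar (-((j : ZMod p) * s)) • g ^ j
  have hs : ∑ j ∈ Finset.range p, f (j + 1) = ∑ j ∈ Finset.range p, f j := by
    have h1 := Finset.sum_range_succ f p
    rw [Finset.sum_range_succ'] at h1
    have h2 : f p = f 0 := by simp [f, hg]
    rw [h2] at h1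
    exact add_right_cancel h1
  have hm : ∀ j, g * f j = (ZMod.stdAddChar s : ℂ) • f (j + 1) := by
    intro j
    simp only [f, Matrix.mul_smul, smul_smul, ← pow_succ']
    rw [← AddChar.map_add_eq_mul]
    congr 2
    push_cast
    ring
  change g * ((p : ℂ)⁻¹ • ∑ j ∈ Finset.range p, f j) = _ • ((p : ℂ)⁻¹ • ∑ j ∈ Finset.range p, f j)
  rw [Matrix.mul_smul, Finset.mul_sum, Finset.sum_congr rfl fun j _ => hm j, ← Finset.smul_sum,
    hs, smul_comm]

lemma eigProj_mul_of_mul_eq {κ : Type} {g : Matrix (Reg p ι) (Reg p ι) ℂ}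
    {X : Matrix (Reg p ι) κ ℂ} {t : ZMod p} (hX : g * X = (ZMod.stdAddChar t : ℂ) • X)
    (s : ZMod p) : eigProj g s * X = if s = t then X else 0 := by
  have hpow : ∀ j : ℕ, g ^ j * X = (ZMod.stdAddChar t : ℂ) ^ j • X := by
    intro j
    induction j with
    | zero => simp
    | succ j ih => rw [pow_succ', Matrix.mul_assoc, ih, Matrix.mul_smul, hX, smul_smul, pow_succ]
  have hp : (p : ℂ) ≠ 0 := Nat.cast_ne_zero.2 (Fact.out : p.Prime).ne_zero
  have key : eigProj g s * X =
      ((p : ℂ)⁻¹ * ∑ j ∈ Finset.range p, (ZMod.stdAddChar (t - s) : ℂ) ^ j) • X := by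
    rw [eigProj, Matrix.smul_mul, Matrix.sum_mul, mul_smul, Finset.sum_smul]
    congr 1
    refine Finset.sum_congr rfl fun j _ => ?_
    rw [Matrix.smul_mul, hpow, smul_smul, ← stdAddChar_natCast_mul, ← stdAddChar_natCast_mul,
      ← AddChar.map_add_eq_mul]
    congr 2
    ring
  rw [key]
  split_ifs with h
  · simp [h, hp]
  · have hne : (ZMod.stdAddChar (t - s) : ℂ) ≠ 1 := by
      rw [Ne, stdAddChar_eq_one_iff, sub_eq_zero]
      exact fun h' => h h'.symm
    have hz : (ZMod.stdAddChar (t - s) : ℂ) ^ p = 1 := by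
      rw [← stdAddChar_natCast_mul]
      simp
    rw [geom_sum_eq hne, hz]
    simp

/-- The eigenprojections resolve the identity by orthogonality of characters; this needs no
assumption on `g`. -/
lemma sum_eigProj (g : Matrix (Reg p ι) (Reg p ι) ℂ) : ∑ s, eigProj g s = 1 := by
  have hp : (p : ℂ) ≠ 0 := Nat.cast_ne_zero.2 (Fact.out : p.Prime).ne_zero
  have hs : ∀ j ∈ Finset.range p, (∑ s : ZMod p, (ZMod.stdAddChar (-((j : ZMod p) * s)) : ℂ)) =
      if j = 0 then (p : ℂ) else 0 := by
    intro j hj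
    have h1 := AddChar.sum_mulShift (-(j : ZMod p)) (ZMod.isPrimitive_stdAddChar p)
    have h2 : ((j : ZMod p) = 0) ↔ j = 0 := by
      rw [ZMod.natCast_eq_zero_iff]
      exact ⟨fun h => Nat.eq_zero_of_dvd_of_lt h (Finset.mem_range.1 hj), fun h => h ▸ dvd_zero p⟩
    simp only [neg_eq_zero, ZMod.card, h2] at h1
    push_cast at h1
    rw [← h1]
    refine Finset.sum_congr rfl fun s _ => ?_
    congr 1
    ring
  simp only [eigProj]
  rw [← Finset.smul_sum, Finset.sum_comm]
  simp only [← Finset.sum_smul]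
  rw [Finset.sum_congr rfl fun j hj => by rw [hs j hj]]
  simp [ite_smul, (Fact.out : p.Prime).ne_zero, smul_smul, hp]

lemma commute_eigProj {g x : Matrix (Reg p ι) (Reg p ι) ℂ} (hx : Commute x g) (s : ZMod p) :
    Commute x (eigProj g s) :=
  (Commute.sum_right _ _ _ fun j _ => (hx.pow_right j).smul_right _).smul_right _

variable {r : ℕ}

lemma syndromeProj_succ (g : Fin (r + 1) → Matrix (Reg p ι) (Reg p ι) ℂ)
    (s : Fin (r + 1) → ZMod p) :
    syndromeProj g s =
      syndromeProj (fun i => g i.succ) (fun i => s i.succ) * eigProj (g 0) (s 0) := by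
  simp [syndromeProj, List.ofFn_succ]

/-- The measurement of a syndrome is complete. -/
lemma sum_syndromeProj (g : Fin r → Matrix (Reg p ι) (Reg p ι) ℂ) :
    ∑ s, syndromeProj g s = 1 := by
  induction r with
  | zero => simp [syndromeProj]
  | succ r ih =>
    rw [← (Fin.consEquiv fun _ => ZMod p).sum_comp, Fintype.sum_prod_type, Finset.sum_comm]
    simp only [syndromeProj_succ, Fin.consEquiv_apply, Fin.cons_zero, Fin.cons_succ]
    simp only [← Finset.mul_sum, sum_eigProj, mul_one, ih]

lemma commute_syndromeProj {g : Fin r → Matrix (Reg p ι) (Reg p ι) ℂ}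
    {x : Matrix (Reg p ι) (Reg p ι) ℂ} (hx : ∀ i, Commute x (g i)) (s : Fin r → ZMod p) :
    Commute x (syndromeProj g s) := by
  induction r with
  | zero => simp [syndromeProj]
  | succ r ih =>
    rw [syndromeProj_succ]
    exact (ih (fun i => hx i.succ) _).mul_right (commute_eigProj (hx 0) _)

lemma mul_syndromeProj {g : Fin r → Matrix (Reg p ι) (Reg p ι) ℂ}
    (hc : ∀ i j, Commute (g i) (g j)) (hp : ∀ i, g i ^ p = 1) (s : Fin r → ZMod p) (i : Fin r) :
    g i * syndromeProj g s = (ZMod.stdAddChar (s i) : ℂ) • syndromeProj g s := by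
  induction r with
  | zero => exact i.elim0
  | succ r ih =>
    rw [syndromeProj_succ]
    refine Fin.cases ?_ (fun i => ?_) i
    · rw [← mul_assoc, (commute_syndromeProj (fun i => hc 0 i.succ) _).eq, mul_assoc,
        mul_eigProj (hp 0), Matrix.mul_smul]
    · rw [← mul_assoc, ih (fun i j => hc i.succ j.succ) (fun i => hp i.succ) (fun i => s i.succ) i,
        Matrix.smul_mul]

/-- A matrix whose columns are joint eigenvectors of syndrome `t` is fixed by the measurement
operator of outcome `t` and annihilated by the others. -/
lemma syndromeProj_mul_of_mul_eq {κ : Type} {g : Fin r → Matrix (Reg p ι) (Reg p ι) ℂ}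
    {X : Matrix (Reg p ι) κ ℂ} {t : Fin r → ZMod p}
    (hX : ∀ i, g i * X = (ZMod.stdAddChar (t i) : ℂ) • X) (s : Fin r → ZMod p) :
    syndromeProj g s * X = if s = t then X else 0 := by
  induction r with
  | zero => simp [syndromeProj, Subsingleton.elim s t]
  | succ r ih =>
    rw [syndromeProj_succ, Matrix.mul_assoc, eigProj_mul_of_mul_eq (hX 0)]
    have hst : s = t ↔ s 0 = t 0 ∧ (fun i => s (Fin.succ i)) = fun i => t (Fin.succ i) := by
      rw [funext_iff, Fin.forall_fin_succ, funext_iff]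
    by_cases h0 : s 0 = t 0
    · rw [if_pos h0, ih (fun i => hX i.succ)]
      simp [hst, h0]
    · simp [hst, h0]

lemma syndromeProj_mul_self {g : Fin r → Matrix (Reg p ι) (Reg p ι) ℂ}
    (hc : ∀ i j, Commute (g i) (g j)) (hp : ∀ i, g i ^ p = 1) (s : Fin r → ZMod p) :
    syndromeProj g s * syndromeProj g s = syndromeProj g s := by
  rw [syndromeProj_mul_of_mul_eq (mul_syndromeProj hc hp s), if_pos rfl]

/-- The joint eigenspaces of commuting unitaries are orthogonal, so the measurement operators,
which sum to the identity, are self-adjoint. -/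
lemma conjTranspose_syndromeProj {g : Fin r → Matrix (Reg p ι) (Reg p ι) ℂ}
    (hc : ∀ i j, Commute (g i) (g j)) (hp : ∀ i, g i ^ p = 1)
    (hu : ∀ i, (g i).conjTranspose * g i = 1) (s : Fin r → ZMod p) :
    (syndromeProj g s).conjTranspose = syndromeProj g s := by
  have h0 : ∀ t, t ≠ s → (syndromeProj g t).conjTranspose * syndromeProj g s = 0 := by
    intro t hts
    obtain ⟨i, hi⟩ := Function.ne_iff.1 hts
    have h1 : (g i * syndromeProj g t).conjTranspose * (g i * syndromeProj g s) =
        (syndromeProj g t).conjTranspose * syndromeProj g s := by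
      rw [Matrix.conjTranspose_mul, Matrix.mul_assoc, ← Matrix.mul_assoc _ (g i), hu,
        Matrix.one_mul]
    rw [mul_syndromeProj hc hp, mul_syndromeProj hc hp, Matrix.conjTranspose_smul,
      Matrix.smul_mul, Matrix.mul_smul, smul_smul, star_stdAddChar, ← AddChar.map_add_eq_mul,
      ← sub_eq_zero] at h1
    nth_rewrite 2 [← one_smul ℂ ((syndromeProj g t).conjTranspose * syndromeProj g s)] at h1
    rw [← sub_smul, smul_eq_zero, sub_eq_zero, stdAddChar_eq_one_iff] at h1
    refine h1.resolve_left fun h => hi ?_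
    linear_combination -h
  have h2 : syndromeProj g s = (syndromeProj g s).conjTranspose * syndromeProj g s := by
    calc syndromeProj g s
        = (∑ t, syndromeProj g t).conjTranspose * syndromeProj g s := by
          rw [sum_syndromeProj, Matrix.conjTranspose_one, Matrix.one_mul]
      _ = _ := by
          rw [Matrix.conjTranspose_sum, Finset.sum_mul, Finset.sum_eq_single s
            (fun t _ ht => h0 t ht) (fun h => absurd (Finset.mem_univ s) h)]
  rw [h2, Matrix.conjTranspose_mul, Matrix.conjTranspose_conjTranspose]

end Projections

/-! ### Pauli operators -/

section Pauli

variable {p : ℕ} [Fact p.Prime] {ι : Type} [Fintype ι]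

lemma pauli_apply (v : Symp p ι) (y x : Reg p ι) :
    pauli v y x = if y = x + v.1 then (ZMod.stdAddChar (v.2 ⬝ᵥ x) : ℂ) else 0 := rfl

lemma pauli_zero : pauli (0 : Symp p ι) = 1 := by
  ext y x
  simp [pauli_apply, Matrix.one_apply]

lemma conjTranspose_pauli (v : Symp p ι) :
    (pauli v).conjTranspose = (ZMod.stdAddChar (v.2 ⬝ᵥ v.1) : ℂ) • pauli (-v) := by
  ext y x
  simp only [Matrix.conjTranspose_apply, pauli_apply, Matrix.smul_apply, smul_eq_mul, Prod.fst_neg,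
    Prod.snd_neg]
  by_cases h : x = y + v.1
  · rw [if_pos h, if_pos (by rw [h]; abel), star_stdAddChar, ← AddChar.map_add_eq_mul, h]
    congr 1
    rw [neg_dotProduct, dotProduct_add]
    ring
  · rw [if_neg h, if_neg (fun h' => h (by rw [h']; abel))]
    simp

lemma pauli_starVec (v : Symp p ι) : pauli (starVec v) = (pauli v).map star := by
  ext y x
  simp only [Matrix.map_apply, pauli_apply, starVec, apply_ite star, star_stdAddChar, star_zero,
    neg_dotProduct]

variable [DecidableEq ι]

lemma pauli_mul (v w : Symp p ι) :
    pauli v * pauli w = (ZMod.stdAddChar (v.2 ⬝ᵥ w.1) : ℂ) • pauli (v + w) := by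
  ext y x
  simp only [Matrix.mul_apply, pauli_apply, mul_ite, mul_zero, Finset.sum_ite_eq',
    Finset.mem_univ, if_true, Matrix.smul_apply, smul_eq_mul, ite_mul, zero_mul,
    Prod.fst_add, Prod.snd_add]
  rw [show x + w.1 + v.1 = x + (v.1 + w.1) by abel]
  split_ifs
  · rw [← AddChar.map_add_eq_mul, ← AddChar.map_add_eq_mul]
    congr 1
    rw [dotProduct_add, add_dotProduct]
    ring
  · rfl

lemma pauli_mul_comm (v w : Symp p ι) :
    pauli w * pauli v = (ZMod.stdAddChar (sympForm v w) : ℂ) • (pauli v * pauli w) := by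
  rw [pauli_mul, pauli_mul, smul_smul, ← AddChar.map_add_eq_mul, add_comm w v]
  congr 2
  rw [sympForm, dotProduct_comm w.2]
  ring

lemma conjTranspose_pauli_mul (u v : Symp p ι) :
    (pauli u).conjTranspose * pauli v =
      (ZMod.stdAddChar (u.2 ⬝ᵥ u.1 - u.2 ⬝ᵥ v.1) : ℂ) • pauli (v - u) := by
  rw [conjTranspose_pauli, Matrix.smul_mul, pauli_mul, smul_smul, ← AddChar.map_add_eq_mul,
    neg_add_eq_sub]
  simp [sub_eq_add_neg]

lemma conjTranspose_pauli_mul_self (v : Symp p ι) : (pauli v).conjTranspose * pauli v = 1 := by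
  rw [conjTranspose_pauli_mul]
  simp [pauli_zero]

end Pauli

/-! ### The observables of a stabilizer code -/

section Observables

variable {p : ℕ} [Fact p.Prime] {ι : Type} [Fintype ι] {r : ℕ}

/-- The syndrome of the Pauli error `v`: the amounts by which it shifts the outcomes of the
observables belonging to `h`. -/
def syndrome (h : Fin r → Symp p ι) (v : Symp p ι) (i : Fin r) : ZMod p := sympForm v (h i)

lemma sympForm_swap (v w : Symp p ι) : sympForm w v = -sympForm v w := by
  simp only [sympForm, dotProduct_comm w.1, dotProduct_comm w.2]
  ring

lemma sympForm_add_left (u v w : Symp p ι) :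
    sympForm (u + v) w = sympForm u w + sympForm v w := by
  simp only [sympForm, Prod.fst_add, Prod.snd_add, add_dotProduct]
  ring

lemma sympForm_smul_left (c : ZMod p) (v w : Symp p ι) :
    sympForm (c • v) w = c * sympForm v w := by
  simp only [sympForm, Prod.smul_fst, Prod.smul_snd, smul_dotProduct, smul_eq_mul]
  ring

lemma sympForm_sub_left (u v w : Symp p ι) :
    sympForm (u - v) w = sympForm u w - sympForm v w := by
  simp only [sympForm, Prod.fst_sub, Prod.snd_sub, sub_dotProduct]
  ring

/-- The symplectic form with its second argument fixed, as a linear functional. -/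
def sympFormLeft (w : Symp p ι) : Symp p ι →ₗ[ZMod p] ZMod p where
  toFun v := sympForm v w
  map_add' u v := sympForm_add_left u v w
  map_smul' c v := sympForm_smul_left c v w

lemma sympForm_nondegenerate [DecidableEq ι] {w : Symp p ι} (hw : ∀ v, sympForm v w = 0) :
    w = 0 := by
  refine Prod.ext (funext fun i => ?_) (funext fun i => ?_)
  · simpa [sympForm] using hw (0, Pi.single i 1)
  · simpa [sympForm] using hw (Pi.single i 1, 0)

/-- Since the symplectic form is nondegenerate, linearly independent `h` have every syndrome. -/
lemma syndrome_surjective [DecidableEq ι] {h : Fin r → Symp p ι}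
    (hli : LinearIndependent (ZMod p) h) : Function.Surjective (syndrome h) := by
  let L : Symp p ι →ₗ[ZMod p] (Fin r → ZMod p) := LinearMap.pi fun i => sympFormLeft (h i)
  change Function.Surjective L
  rw [← LinearMap.dualMap_injective_iff, injective_iff_map_eq_zero]
  intro f hf
  have h1 : ∑ i, f (Pi.single i 1) • h i = 0 := by
    refine sympForm_nondegenerate fun v => ?_
    have h2 : f (L v) = 0 := LinearMap.congr_fun hf v
    rw [LinearMap.pi_apply_eq_sum_univ f (L v)] at h2
    rw [← h2, ← neg_eq_iff_eq_neg.2 (sympForm_swap v _)]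
    have h3 := map_sum (sympFormLeft v) (fun i => f (Pi.single i 1) • h i) Finset.univ
    change sympForm _ v = _ at h3
    rw [h3, ← Finset.sum_neg_distrib]
    refine Finset.sum_congr rfl fun i _ => ?_
    rw [map_smul]
    change -(f _ • sympForm (h i) v) = sympForm v (h i) • f _
    rw [sympForm_swap v (h i), smul_eq_mul, mul_neg, neg_neg, smul_eq_mul, mul_comm]
    congr 2
    funext j
    simp [Pi.single_apply, eq_comm]
  have h4 := Fintype.linearIndependent_iff.1 hli _ h1
  refine LinearMap.pi_ext' fun i => LinearMap.ext_ring ?_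
  simpa using h4 i

variable {h : Fin r → Symp p ι} {φ : Fin r → ℂ}

/-- The phases have absolute value one, because `g ^ p = 1` for the observables. -/
lemma star_mul_self_eq_one [DecidableEq ι] (hφ : ∀ i, bobObservable h φ i ^ p = 1) (i : Fin r) :
    star (φ i) * φ i = 1 := by
  have h1 : ∀ j : ℕ, (bobObservable h φ i ^ j).conjTranspose * bobObservable h φ i ^ j =
      (star (φ i) * φ i) ^ j • (1 : Matrix (Reg p ι) (Reg p ι) ℂ) := by
    intro j
    induction j with
    | zero => simp
    | succ j ih =>
      have h2 : (bobObservable h φ i).conjTranspose * bobObservable h φ i =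
          (star (φ i) * φ i) • (1 : Matrix (Reg p ι) (Reg p ι) ℂ) := by
        rw [bobObservable, Matrix.conjTranspose_smul, Matrix.smul_mul, Matrix.mul_smul, smul_smul,
          conjTranspose_pauli_mul_self]
      rw [pow_succ', Matrix.conjTranspose_mul, Matrix.mul_assoc,
        ← Matrix.mul_assoc _ (bobObservable h φ i), h2, Matrix.smul_mul, Matrix.one_mul,
        Matrix.mul_smul, ih, smul_smul, pow_succ']
  have h3 := congrFun (congrFun (h1 p) 0) 0
  rw [hφ, Matrix.conjTranspose_one, Matrix.one_mul, Matrix.smul_apply, Matrix.one_apply_eq,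
    smul_eq_mul, mul_one] at h3
  have h4 : star (φ i) * φ i = ((‖φ i‖ ^ 2 : ℝ) : ℂ) := by
    rw [mul_comm]
    exact_mod_cast Complex.mul_conj' (φ i)
  rw [h4] at h3 ⊢
  have h5 : (‖φ i‖ ^ 2) ^ p = 1 := by exact_mod_cast h3.symm
  rw [(pow_eq_one_iff_of_nonneg (by positivity) (Fact.out : p.Prime).ne_zero).1 h5]
  simp

lemma conjTranspose_bobObservable_mul_self [DecidableEq ι]
    (hφ : ∀ i, bobObservable h φ i ^ p = 1) (i : Fin r) :
    (bobObservable h φ i).conjTranspose * bobObservable h φ i = 1 := by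
  rw [bobObservable, Matrix.conjTranspose_smul, Matrix.smul_mul, Matrix.mul_smul, smul_smul,
    conjTranspose_pauli_mul_self, star_mul_self_eq_one hφ, one_smul]

lemma commute_bobObservable [DecidableEq ι] (hiso : ∀ i j, sympForm (h i) (h j) = 0)
    (i j : Fin r) :
    Commute (bobObservable h φ i) (bobObservable h φ j) := by
  have h1 : Commute (pauli (h i)) (pauli (h j)) := by
    have h2 := pauli_mul_comm (h j) (h i)
    rwa [hiso, AddChar.map_zero_eq_one, one_smul] at h2
  exact (h1.smul_left _).smul_right _

lemma aliceObservable_eq (i : Fin r) :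
    aliceObservable h φ i = (bobObservable h φ i).map star := by
  rw [aliceObservable, pauli_starVec]
  ext y x
  simp [bobObservable]

lemma eigProj_map_star [DecidableEq ι] (g : Matrix (Reg p ι) (Reg p ι) ℂ) (s : ZMod p) :
    eigProj (g.map star) s = (eigProj g (-s)).map star := by
  have h1 : ∀ M : Matrix (Reg p ι) (Reg p ι) ℂ, M.map star = (starRingEnd ℂ).mapMatrix M :=
    fun _ => rfl
  have h2 : ∀ (c : ℂ) (M : Matrix (Reg p ι) (Reg p ι) ℂ),
      (starRingEnd ℂ).mapMatrix (c • M) = star c • (starRingEnd ℂ).mapMatrix M := by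
    intro c M
    ext
    simp
  rw [h1, h1, eigProj, eigProj, h2, map_sum]
  simp only [h2, map_pow, star_stdAddChar, star_inv₀, star_natCast, mul_neg, neg_neg]

/-- Alice's measurement operators are the entrywise conjugates of Bob's, with the opposite
outcome. -/
lemma syndromeProj_aliceObservable [DecidableEq ι] (s : Fin r → ZMod p) :
    syndromeProj (aliceObservable h φ) s = (syndromeProj (bobObservable h φ) (-s)).map star := by
  change _ = (starRingEnd ℂ).mapMatrix _
  rw [syndromeProj, syndromeProj, map_list_prod, List.map_reverse, List.map_ofFn]
  congr 3
  funext i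
  rw [aliceObservable_eq, eigProj_map_star]
  rfl

variable [DecidableEq ι]

lemma bobObservable_mul_pauli (v : Symp p ι) (i : Fin r) :
    bobObservable h φ i * pauli v =
      (ZMod.stdAddChar (syndrome h v i) : ℂ) • (pauli v * bobObservable h φ i) := by
  rw [bobObservable, Matrix.smul_mul, pauli_mul_comm v (h i), Matrix.mul_smul, smul_comm, syndrome]

variable (hiso : ∀ i j, sympForm (h i) (h j) = 0) (hφ : ∀ i, bobObservable h φ i ^ p = 1)

include hiso hφ

lemma syndromeProj_mul_pauli_mul (v : Symp p ι) (s t : Fin r → ZMod p) :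
    syndromeProj (bobObservable h φ) s * (pauli v * syndromeProj (bobObservable h φ) t) =
      if s = syndrome h v + t then pauli v * syndromeProj (bobObservable h φ) t else 0 := by
  refine syndromeProj_mul_of_mul_eq (fun i => ?_) s
  rw [← Matrix.mul_assoc, bobObservable_mul_pauli, Matrix.smul_mul, Matrix.mul_assoc,
    mul_syndromeProj (commute_bobObservable hiso) hφ, Matrix.mul_smul, smul_smul,
    ← AddChar.map_add_eq_mul, Pi.add_apply]

lemma syndromeProj_mul_pauli (v : Symp p ι) (s : Fin r → ZMod p) :
    syndromeProj (bobObservable h φ) (syndrome h v + s) * pauli v =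
      pauli v * syndromeProj (bobObservable h φ) s := by
  calc _ = syndromeProj (bobObservable h φ) (syndrome h v + s) *
        (pauli v * ∑ t, syndromeProj (bobObservable h φ) t) := by
          rw [sum_syndromeProj, Matrix.mul_one]
    _ = _ := by
      rw [Matrix.mul_sum, Matrix.mul_sum]
      simp only [syndromeProj_mul_pauli_mul hiso hφ, add_right_inj]
      simp

/-- Pauli operators permute the code spaces of the different syndromes transitively, so all of
them have the same dimension. -/
lemma trace_syndromeProj (hli : LinearIndependent (ZMod p) h) (s : Fin r → ZMod p) :
    (p : ℂ) ^ r * (syndromeProj (bobObservable h φ) s).trace = (p : ℂ) ^ Fintype.card ι := by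
  have h1 : ∀ t, (syndromeProj (bobObservable h φ) t).trace =
      (syndromeProj (bobObservable h φ) s).trace := by
    intro t
    -- `Π_t = P_v Π_s P_v†` for an error `v` of syndrome `t - s`.
    obtain ⟨v, hv⟩ := syndrome_surjective hli (t - s)
    have h2 := syndromeProj_mul_pauli hiso hφ v s
    rw [hv, sub_add_cancel] at h2
    rw [← Matrix.mul_one (syndromeProj (bobObservable h φ) t),
      ← mul_eq_one_comm.1 (conjTranspose_pauli_mul_self v), ← Matrix.mul_assoc, h2,
      Matrix.trace_mul_comm, ← Matrix.mul_assoc, conjTranspose_pauli_mul_self, Matrix.one_mul]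
  have h3 := congrArg Matrix.trace (sum_syndromeProj (bobObservable h φ))
  rw [Matrix.trace_sum, Finset.sum_congr rfl fun t _ => h1 t, Matrix.trace_one] at h3
  simpa [ZMod.card] using h3

/-- Pauli operators in the span of the stabilizer generators act on each code space as scalars. -/
lemma exists_pauli_mul_syndromeProj {w : Symp p ι}
    (hw : w ∈ Submodule.span (ZMod p) (Set.range h)) (s : Fin r → ZMod p) :
    ∃ c : ℂ, pauli w * syndromeProj (bobObservable h φ) s =
      c • syndromeProj (bobObservable h φ) s := by
  have hadd : ∀ x y : Symp p ι,
      (∃ c : ℂ, pauli x * syndromeProj (bobObservable h φ) s =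
        c • syndromeProj (bobObservable h φ) s) →
      (∃ c : ℂ, pauli y * syndromeProj (bobObservable h φ) s =
        c • syndromeProj (bobObservable h φ) s) →
      ∃ c : ℂ, pauli (x + y) * syndromeProj (bobObservable h φ) s =
        c • syndromeProj (bobObservable h φ) s := by
    rintro x y ⟨a, ha⟩ ⟨b, hb⟩
    have h1 : pauli (x + y) =
        (ZMod.stdAddChar (-(x.2 ⬝ᵥ y.1)) : ℂ) • (pauli x * pauli y) := by
      rw [pauli_mul, smul_smul, ← AddChar.map_add_eq_mul]
      simp
    refine ⟨ZMod.stdAddChar (-(x.2 ⬝ᵥ y.1)) * (b * a), ?_⟩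
    rw [h1, Matrix.smul_mul, Matrix.mul_assoc, hb, Matrix.mul_smul, ha, smul_smul, smul_smul,
      mul_assoc]
  have hzero : ∃ c : ℂ, pauli (0 : Symp p ι) * syndromeProj (bobObservable h φ) s =
      c • syndromeProj (bobObservable h φ) s := ⟨1, by rw [pauli_zero, Matrix.one_mul, one_smul]⟩
  induction hw using Submodule.span_induction with
  | mem x hx =>
    obtain ⟨i, rfl⟩ := hx
    have h1 := mul_syndromeProj (commute_bobObservable hiso) hφ s i
    refine ⟨star (φ i) * ZMod.stdAddChar (s i), ?_⟩
    rw [mul_smul, ← h1, bobObservable, Matrix.smul_mul, smul_smul, star_mul_self_eq_one hφ,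
      one_smul]
  | zero => exact hzero
  | add x y _ _ hx hy => exact hadd x y hx hy
  | smul a x _ hx =>
    have h2 : ∀ m : ℕ, ∃ c : ℂ, pauli (m • x) * syndromeProj (bobObservable h φ) s =
        c • syndromeProj (bobObservable h φ) s := by
      intro m
      induction m with
      | zero => simpa only [zero_smul] using hzero
      | succ m ih => rw [succ_nsmul]; exact hadd _ _ ih hx
    have h3 := h2 a.val
    rwa [← Nat.cast_smul_eq_nsmul (ZMod p), ZMod.natCast_zmod_val] at h3

/-- An encoding operator takes the information qudits, with the ancillas in the basis state `j`,
onto the whole code space: both have dimension `p ^ k`. -/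
lemma exists_conjTranspose_mul_syndromeProj_mul {k : ℕ} (hli : LinearIndependent (ZMod p) h)
    (hcard : r + k = Fintype.card ι) {s : Fin r → ZMod p}
    {U : Matrix (Reg p ι) (Reg p (Fin k) × Reg p (Fin r)) ℂ}
    (hU : IsEncoder (bobObservable h φ) s U) :
    ∃ j : Reg p (Fin r), U.conjTranspose * syndromeProj (bobObservable h φ) s * U =
      (1 : Matrix (Reg p (Fin k)) (Reg p (Fin k)) ℂ) ⊗ₖ Matrix.single j j (1 : ℂ) := by
  obtain ⟨hU1, hU2, j, hj⟩ := hU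
  refine ⟨j, ?_⟩
  set P := syndromeProj (bobObservable h φ) s with hP
  set R : Matrix (Reg p (Fin k) × Reg p (Fin r)) (Reg p (Fin k) × Reg p (Fin r)) ℂ :=
    (1 : Matrix (Reg p (Fin k)) (Reg p (Fin k)) ℂ) ⊗ₖ Matrix.single j j (1 : ℂ) with hR
  have hPh : P.conjTranspose = P := conjTranspose_syndromeProj (commute_bobObservable hiso) hφ
    (conjTranspose_bobObservable_mul_self hφ) s
  have hPP : P * P = P := syndromeProj_mul_self (commute_bobObservable hiso) hφ s
  have hRh : R.conjTranspose = R := by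
    rw [hR, Matrix.conjTranspose_kronecker, Matrix.conjTranspose_one, Matrix.conjTranspose_single,
      star_one]
  have hRR : R * R = R := by
    rw [hR, ← Matrix.mul_kronecker_mul, Matrix.one_mul, Matrix.single_mul_single_same, one_mul]
  have hURa : ∀ x i j', (U * R) x (i, j') = if j' = j then U x (i, j) else 0 := by
    intro x i j'
    rw [Matrix.mul_apply, Fintype.sum_prod_type]
    simp only [hR, Matrix.kroneckerMap_apply, Matrix.one_apply, Matrix.single_apply]
    by_cases hjj : j' = j
    · simp [hjj]
    · simp [hjj, Ne.symm hjj]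
  have hPUR : P * (U * R) = U * R := by
    have h1 : ∀ i, bobObservable h φ i * (U * R) = (ZMod.stdAddChar (s i) : ℂ) • (U * R) := by
      intro i
      ext x ⟨i', j'⟩
      have h2 := congrFun (hj i' i) x
      rw [Matrix.mul_apply, Matrix.smul_apply]
      simp only [hURa]
      by_cases hjj : j' = j
      · simpa [hjj, Matrix.mulVec, dotProduct] using h2
      · simp [hjj]
    rw [hP, syndromeProj_mul_of_mul_eq h1, if_pos rfl]
  set Q := U.conjTranspose * P * U with hQ
  have hQR : Q * R = R := by
    rw [hQ, Matrix.mul_assoc, Matrix.mul_assoc, hPUR, ← Matrix.mul_assoc, hU1, Matrix.one_mul]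
  have hQh : Q.conjTranspose = Q := by
    rw [hQ, Matrix.conjTranspose_mul, Matrix.conjTranspose_mul, hPh,
      Matrix.conjTranspose_conjTranspose, Matrix.mul_assoc]
  have hQQ : Q * Q = Q := by
    calc Q * Q = U.conjTranspose * (P * (U * U.conjTranspose) * P) * U := by
          simp only [hQ, Matrix.mul_assoc]
      _ = Q := by rw [hU2, Matrix.mul_one, hPP]
  have hRQ : R * Q = R := by
    have h1 := congrArg Matrix.conjTranspose hQR
    rwa [Matrix.conjTranspose_mul, hQh, hRh] at h1
  -- `Q - R` is an orthogonal projection of trace zero.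
  have htr : (Q - R).trace = 0 := by
    have hp : (p : ℂ) ^ r ≠ 0 := pow_ne_zero _ (Nat.cast_ne_zero.2 (Fact.out : p.Prime).ne_zero)
    have h1 := trace_syndromeProj hiso hφ hli s
    have h2 : Q.trace = P.trace := by
      rw [hQ, Matrix.trace_mul_comm, ← Matrix.mul_assoc, hU2, Matrix.one_mul]
    have h3 : R.trace = (p : ℂ) ^ k := by
      rw [hR, Matrix.trace_kronecker, Matrix.trace_one, Matrix.trace_single_eq_same]
      simp [ZMod.card]
    rw [Matrix.trace_sub, h2, h3, sub_eq_zero]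
    refine mul_left_cancel₀ hp ?_
    rw [h1, ← pow_add, hcard]
  rw [← sub_eq_zero, ← Matrix.trace_conjTranspose_mul_self_eq_zero_iff, Matrix.conjTranspose_sub,
    hQh, hRh, Matrix.sub_mul, Matrix.mul_sub, Matrix.mul_sub, hQQ, hQR, hRQ, hRR, sub_self,
    sub_zero, htr]

end Observables

/-! ### Decoding errors on the noisy qudits -/

section Decoding

variable {p n c : ℕ}

/-- A Pauli error on the first `n` qudits, as one on all `n + c`. -/
def padZero (c : ℕ) (v : Symp p (Fin n)) : Symp p (Fin n ⊕ Fin c) :=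
  (Sum.elim v.1 0, Sum.elim v.2 0)

lemma padZero_sub (u v : Symp p (Fin n)) : padZero c (u - v) = padZero c u - padZero c v := by
  refine Prod.ext (funext fun i => ?_) (funext fun i => ?_) <;> cases i <;> simp [padZero]

/-- The number of errors of `v` outside the set `E`. -/
def weightOutside (E : Finset (Fin n)) (v : Symp p (Fin n)) : ℕ :=
  (Finset.univ.filter fun i => i ∉ E ∧ (v.1 i, v.2 i) ≠ (0, 0)).card

/-- Positions in `E` are counted once, those outside once for each of the two errors; this is
where `2t + e` comes from. -/
lemma sympWeight_sub_le (E : Finset (Fin n)) (u v : Symp p (Fin n)) :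
    sympWeight (u - v) ≤ E.card + (weightOutside E u + weightOutside E v) := by
  refine le_trans (Finset.card_le_card ?_) ((Finset.card_union_le _ _).trans
    (Nat.add_le_add_left (Finset.card_union_le _ _) _))
  intro i hi
  simp only [Finset.mem_filter, Finset.mem_univ, true_and, Finset.mem_union, Prod.fst_sub,
    Prod.snd_sub, Pi.sub_apply] at hi ⊢
  by_contra hcon
  push Not at hcon
  obtain ⟨h1, h2, h3⟩ := hcon
  have h2 := Prod.mk.inj (h2 h1)
  have h3 := Prod.mk.inj (h3 h1)
  exact hi (by rw [h2.1, h2.2, h3.1, h3.2, sub_zero])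

variable [Fact p.Prime] {k r : ℕ}

/-- A decoder that finds, for every syndrome of an error on the noisy qudits, an error on them
with that syndrome and the fewest errors outside the erasures. -/
lemma exists_decoder (h : Fin r → Symp p (Fin n ⊕ Fin c)) :
    ∃ dec : Finset (Fin n) → (Fin r → ZMod p) → Symp p (Fin n ⊕ Fin c),
      ∀ E v, ∃ u, dec E (syndrome h (padZero c v)) = padZero c u ∧
        syndrome h (padZero c u) = syndrome h (padZero c v) ∧
        weightOutside E u ≤ weightOutside E v := by
  have h1 : ∀ (E : Finset (Fin n)) (s : Fin r → ZMod p), ∃ w : Symp p (Fin n ⊕ Fin c),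
      ∀ v, syndrome h (padZero c v) = s → ∃ u, w = padZero c u ∧
        syndrome h (padZero c u) = s ∧ weightOutside E u ≤ weightOutside E v := by
    intro E s
    by_cases hne : ({v : Symp p (Fin n) | syndrome h (padZero c v) = s}).Nonempty
    · obtain ⟨u, hu, hmin⟩ := Set.exists_min_image _ (weightOutside E) (Set.toFinite _) hne
      exact ⟨padZero c u, fun v hv => ⟨u, rfl, hu, hmin v hv⟩⟩
    · exact ⟨0, fun v hv => (hne ⟨v, hv⟩).elim⟩
  choose dec hdec using h1
  exact ⟨dec, fun E v => hdec E _ v rfl⟩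

/-- The restriction of vectors to the noisy qudits. -/
def restrictLeft (p n c : ℕ) : Symp p (Fin n ⊕ Fin c) →ₗ[ZMod p] Symp p (Fin n) :=
  LinearMap.prodMap (LinearMap.funLeft (ZMod p) (ZMod p) Sum.inl)
    (LinearMap.funLeft (ZMod p) (ZMod p) Sum.inl)

/-- The restriction of vectors to the preshared qudits. -/
def restrictRight (p n c : ℕ) : Symp p (Fin n ⊕ Fin c) →ₗ[ZMod p] Symp p (Fin c) :=
  LinearMap.prodMap (LinearMap.funLeft (ZMod p) (ZMod p) Sum.inr)
    (LinearMap.funLeft (ZMod p) (ZMod p) Sum.inr)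

lemma eq_padZero_of_restrictRight_eq_zero {x : Symp p (Fin n ⊕ Fin c)}
    (hx : restrictRight p n c x = 0) : x = padZero c (restrictLeft p n c x) := by
  have h1 := congrArg Prod.fst hx
  have h2 := congrArg Prod.snd hx
  refine Prod.ext (funext fun i => ?_) (funext fun i => ?_)
  · rcases i with i | i
    · rfl
    · exact congrFun h1 i
  · rcases i with i | i
    · rfl
    · exact congrFun h2 i

lemma sympForm_padZero (x : Symp p (Fin n ⊕ Fin c)) (w : Symp p (Fin n)) :
    sympForm x (padZero c w) = sympForm (restrictLeft p n c x) w := by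
  simp [sympForm, padZero, restrictLeft, dotProduct, LinearMap.funLeft_apply]

/-- The isotropic part of `D` comes from the vectors of `C` that vanish on the preshared qudits.
The former has dimension `dim D - 2c`; the latter are cut out by `2c` equations in a space of
the same dimension as `D`, on which puncturing is injective. -/
lemma padZero_mem_of_mem_inf {C : Submodule (ZMod p) (Symp p (Fin n ⊕ Fin c))} {d : ℕ∞}
    (hD : IsEACode (puncture C) k d c) (hC : IsStabilizerCode C k) {w : Symp p (Fin n)}
    (hw : w ∈ puncture C ⊓ sympCompl (puncture C)) : padZero c w ∈ C := by
  obtain ⟨hiso, hdimC⟩ := hC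
  obtain ⟨hdimD, hrad, -⟩ := hD
  set D := puncture C with hDdef
  have hmap : D = C.map (restrictLeft p n c) := rfl
  have hfin : Module.finrank (ZMod p) D = Module.finrank (ZMod p) C := by
    have h1 : Fintype.card (Fin n ⊕ Fin c) = n + c := by simp
    omega
  -- Puncturing preserves the dimension of `C`, hence is injective on it.
  have hinj : Function.Injective ((restrictLeft p n c).domRestrict C) := by
    have h1 := LinearMap.finrank_range_add_finrank_ker ((restrictLeft p n c).domRestrict C)
    rw [LinearMap.range_domRestrict, ← hmap, hfin] at h1
    rw [← LinearMap.ker_eq_bot, ← Submodule.finrank_eq_zero (R := ZMod p)]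
    omega
  let R : C →ₗ[ZMod p] Symp p (Fin c) := (restrictRight p n c).domRestrict C
  let K : Submodule (ZMod p) (Symp p (Fin n)) :=
    (LinearMap.ker R).map ((restrictLeft p n c).domRestrict C)
  have hKle : K ≤ D ⊓ sympCompl D := by
    rintro _ ⟨x, hx, rfl⟩
    have hx0 : restrictRight p n c x = 0 := hx
    have hxp := eq_padZero_of_restrictRight_eq_zero hx0
    refine ⟨⟨x, x.2, rfl⟩, ?_⟩
    rintro _ ⟨y, hy, rfl⟩
    have h1 := hiso x.2 y hy
    rw [hxp, sympForm_padZero] at h1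
    exact h1
  have hKdim : Module.finrank (ZMod p) D ≤ Module.finrank (ZMod p) K + 2 * c := by
    have h1 := LinearMap.finrank_range_add_finrank_ker R
    have h2 : Module.finrank (ZMod p) (LinearMap.range R) ≤ 2 * c := by
      refine (Submodule.finrank_le _).trans (le_of_eq ?_)
      rw [Module.finrank_prod, Module.finrank_fintype_fun_eq_card, Fintype.card_fin, two_mul]
    have h3 : Module.finrank (ZMod p) K = Module.finrank (ZMod p) (LinearMap.ker R) :=
      
      (Submodule.equivMapOfInjective _ hinj _).finrank_eq.symm
    omega
  have hK : K = D ⊓ sympCompl D := Submodule.eq_of_le_of_finrank_le hKle (by omega)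
  rw [← hK] at hw
  obtain ⟨x, hx, rfl⟩ := hw
  have hx0 : restrictRight p n c x = 0 := hx
  change padZero c (restrictLeft p n c x) ∈ C
  rw [← eq_padZero_of_restrictRight_eq_zero hx0]
  exact x.2

/-- Errors on few noisy qudits that have the same syndrome differ by a stabilizer. -/
lemma padZero_sub_mem {C : Submodule (ZMod p) (Symp p (Fin n ⊕ Fin c))} {d : ℕ∞}
    (hD : IsEACode (puncture C) k d c) (hC : IsStabilizerCode C k)
    {h : Fin r → Symp p (Fin n ⊕ Fin c)} (hspan : Submodule.span (ZMod p) (Set.range h) = C)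
    {E : Finset (Fin n)} {t : ℕ} (ht : ((2 * t + E.card : ℕ) : ℕ∞) < d)
    {u v : Symp p (Fin n)} (huv : syndrome h (padZero c u) = syndrome h (padZero c v))
    (hu : weightOutside E u ≤ t) (hv : weightOutside E v ≤ t) :
    padZero c v - padZero c u ∈ C := by
  rw [← padZero_sub]
  refine padZero_mem_of_mem_inf hD hC ?_
  have h1 : v - u ∈ sympCompl (puncture C) := by
    rintro _ ⟨x, hx, rfl⟩
    change sympForm (restrictLeft p n c x) (v - u) = 0
    rw [← sympForm_padZero]
    have h2 : C ≤ LinearMap.ker (sympFormLeft (padZero c (v - u))) := by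
      rw [← hspan, Submodule.span_le]
      rintro _ ⟨i, rfl⟩
      change sympForm (h i) (padZero c (v - u)) = 0
      rw [sympForm_swap (padZero c (v - u)), padZero_sub, sympForm_sub_left, neg_eq_zero,
        sub_eq_zero]
      exact (congrFun huv i).symm
    exact h2 hx
  refine ⟨?_, h1⟩
  by_contra h2
  have h3 : d ≤ (sympWeight (v - u) : ℕ∞) := by
    rw [← hD.2.2]
    exact iInf₂_le (v - u) ⟨h1, h2⟩
  have h4 : sympWeight (v - u) ≤ 2 * t + E.card := by
    have := sympWeight_sub_le E v u
    omega
  exact absurd (lt_of_lt_of_le ht h3) (not_lt.2 (Nat.cast_le.2 h4))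

end Decoding

/-! ### Noisy states in terms of Pauli errors -/

section Noise

variable {p : ℕ}

lemma prod_bell {ι : Type} (s : Finset ι) (x y : Reg p ι) :
    ∏ i ∈ s, bell p (x i) (y i) =
      if ∀ i ∈ s, x i = y i then (((Real.sqrt p : ℝ) : ℂ)⁻¹) ^ s.card else 0 := by
  simp only [bell, Finset.prod_ite_zero, Finset.prod_const]

lemma maxEnt_apply {ι : Type} [Fintype ι] (x y : Reg p ι) :
    maxEnt p ι (x, y) = if x = y then (((Real.sqrt p : ℝ) : ℂ)⁻¹) ^ Fintype.card ι else 0 := by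
  rw [maxEnt, prod_bell]
  simp [funext_iff]

lemma maxEntOp_apply {ι : Type} [Fintype ι] (u v : Reg p ι × Reg p ι) :
    maxEntOp p ι u v = if u.1 = u.2 ∧ v.1 = v.2 then ((p : ℂ) ^ Fintype.card ι)⁻¹ else 0 := by
  obtain ⟨x, y⟩ := u
  obtain ⟨x', y'⟩ := v
  have h1 : (((Real.sqrt p : ℝ) : ℂ)⁻¹) * ((Real.sqrt p : ℝ) : ℂ)⁻¹ = (p : ℂ)⁻¹ := by
    rw [← mul_inv, ← Complex.ofReal_mul, Real.mul_self_sqrt (Nat.cast_nonneg p)]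
    simp
  rw [maxEntOp, Matrix.vecMulVec_apply, Pi.star_apply, maxEnt_apply, maxEnt_apply]
  by_cases hx : x = y
  · by_cases hy : x' = y'
    · simp only [hx, hy, if_true, and_self, star_pow, star_inv₀, Complex.star_def,
        Complex.conj_ofReal]
      rw [← mul_pow, h1, inv_pow]
    · simp [hy]
  · simp [hx]

lemma conjTranspose_maxEntOp (ι : Type) [Fintype ι] :
    (maxEntOp p ι).conjTranspose = maxEntOp p ι := by
  rw [maxEntOp, Matrix.conjTranspose_vecMulVec, star_star]

lemma conjTranspose_withPerfectPairs {n : ℕ} (c : ℕ) {σ : PairOp p (Fin n)}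
    (hσ : σ.conjTranspose = σ) :
    (withPerfectPairs c σ).conjTranspose = withPerfectPairs c σ := by
  ext u v
  have h1 := fun a b => congrFun (congrFun hσ a) b
  have h2 := fun a b => congrFun (congrFun (conjTranspose_maxEntOp (p := p) (Fin c)) a) b
  simp only [Matrix.conjTranspose_apply] at h1 h2
  simp only [withPerfectPairs, Matrix.conjTranspose_apply, Matrix.of_apply, star_mul', h1, h2]

variable [Fact p.Prime]

lemma trace_maxEntOp (ι : Type) [Fintype ι] [DecidableEq ι] : (maxEntOp p ι).trace = 1 := by
  have hp : (p : ℂ) ≠ 0 := Nat.cast_ne_zero.2 (Fact.out : p.Prime).ne_zero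
  simp [Matrix.trace, Fintype.sum_prod_type, maxEntOp_apply, ZMod.card, hp]

lemma sum_stdAddChar_dotProduct {κ : Type} [Fintype κ] [DecidableEq κ] (w : κ → ZMod p) :
    ∑ b : κ → ZMod p, (ZMod.stdAddChar (b ⬝ᵥ w) : ℂ) =
      if w = 0 then (p : ℂ) ^ Fintype.card κ else 0 := by
  have h1 : ∀ b : κ → ZMod p, (ZMod.stdAddChar (b ⬝ᵥ w) : ℂ) =
      ∏ i, ZMod.stdAddChar (b i * w i) := fun b =>
    map_prod (ZMod.stdAddChar (N := p)).toMonoidHom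
      (fun i => Multiplicative.ofAdd (b i * w i)) Finset.univ
  simp only [h1]
  rw [← Fintype.prod_sum fun i (x : ZMod p) => (ZMod.stdAddChar (x * w i) : ℂ)]
  have h2 : ∀ i, ∑ x : ZMod p, (ZMod.stdAddChar (x * w i) : ℂ) =
      if w i = 0 then (p : ℂ) else 0 := by
    intro i
    rw [AddChar.sum_mulShift (w i) (ZMod.isPrimitive_stdAddChar p), ZMod.card]
    simp
  simp only [h2, Finset.prod_ite_zero, Finset.prod_const, funext_iff, Pi.zero_apply,
    Finset.mem_univ, true_imp_iff, Finset.card_univ]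

/-- Every function on `F_p^κ` is a linear combination of characters (Fourier inversion). -/
lemma sum_fourier {κ : Type} [Fintype κ] [DecidableEq κ] (f : (κ → ZMod p) → ℂ)
    (w : κ → ZMod p) :
    ∑ b : κ → ZMod p, (((p : ℂ) ^ Fintype.card κ)⁻¹ *
      ∑ z, f z * ZMod.stdAddChar (b ⬝ᵥ (-z))) * ZMod.stdAddChar (b ⬝ᵥ w) = f w := by
  have hp : (p : ℂ) ≠ 0 := Nat.cast_ne_zero.2 (Fact.out : p.Prime).ne_zero
  have h1 : ∀ b : κ → ZMod p, (((p : ℂ) ^ Fintype.card κ)⁻¹ *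
      ∑ z, f z * ZMod.stdAddChar (b ⬝ᵥ (-z))) * ZMod.stdAddChar (b ⬝ᵥ w) =
      ((p : ℂ) ^ Fintype.card κ)⁻¹ * ∑ z, f z * ZMod.stdAddChar (b ⬝ᵥ (w - z)) := by
    intro b
    rw [mul_assoc, Finset.sum_mul]
    congr 1
    refine Finset.sum_congr rfl fun z _ => ?_
    rw [mul_assoc, ← AddChar.map_add_eq_mul, ← dotProduct_add, neg_add_eq_sub]
  simp only [h1]
  rw [← Finset.mul_sum, Finset.sum_comm]
  simp only [← Finset.mul_sum, sum_stdAddChar_dotProduct, sub_eq_zero]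
  simp only [Finset.sum_ite_eq, Finset.mem_univ, if_true, mul_ite, mul_zero]
  field_simp

variable {n : ℕ} (c : ℕ)

/-- Adjoining `c` perfect pairs to a state vector of `n` pairs. -/
noncomputable def adjoinMaxEnt : (Reg p (Fin n) × Reg p (Fin n) → ℂ) →ₗ[ℂ]
    (Reg p (Fin n ⊕ Fin c) × Reg p (Fin n ⊕ Fin c) → ℂ) where
  toFun ψ u := ψ (fun i => u.1 (Sum.inl i), fun i => u.2 (Sum.inl i)) *
    maxEnt p (Fin c) (fun i => u.1 (Sum.inr i), fun i => u.2 (Sum.inr i))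
  map_add' ψ ψ' := by ext u; simp [add_mul]
  map_smul' a ψ := by ext u; simp [mul_assoc]

/-- The vectors that result from a maximally entangled state of all pairs by Pauli errors, at
most `t` of them outside `E`, on Bob's halves of the noisy pairs (up to a constant factor: the
vectorization of the identity matrix is an unnormalized maximally entangled state). -/
def pauliErrorVectors (E : Finset (Fin n)) (t : ℕ) :
    Set (Reg p (Fin n ⊕ Fin c) × Reg p (Fin n ⊕ Fin c) → ℂ) :=
  {ψ | ∃ v, weightOutside E v ≤ t ∧ ψ = Matrix.vec (pauli (padZero c v))}

/-- Extension by zero of a vector on a subset of the qudits. -/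
def extendZero (S : Finset (Fin n)) (a : Reg p S) (i : Fin n) : ZMod p :=
  if hi : i ∈ S then a ⟨i, hi⟩ else 0

lemma extendZero_dotProduct (S : Finset (Fin n)) (b : Reg p S) (x : Reg p (Fin n)) :
    extendZero S b ⬝ᵥ x = b ⬝ᵥ fun i : S => x i := by
  rw [dotProduct, dotProduct, ← Finset.sum_subset (Finset.subset_univ S)]
  · rw [← Finset.sum_coe_sort S]
    refine Finset.sum_congr rfl fun i _ => ?_
    simp [extendZero]
  · intro i _ hi
    simp [extendZero, hi]

lemma weightOutside_extendZero_le (E T : Finset (Fin n)) (a b : Reg p ↥(E ∪ T)) :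
    weightOutside E ((extendZero (E ∪ T) a, extendZero (E ∪ T) b) : Symp p (Fin n)) ≤ T.card := by
  refine Finset.card_le_card fun i hi => ?_
  simp only [Finset.mem_filter, Finset.mem_univ, true_and] at hi
  by_contra hiT
  have h1 : i ∉ E ∪ T := by simp [hi.1, hiT]
  exact hi.2 (by simp [extendZero, h1])

/-- The Pauli operators on a set of qudits span all operators on them, so an arbitrary error on
the pairs in `E ∪ T` is a superposition of Pauli errors on Bob's side. -/
lemma adjoinMaxEnt_mem_span {E T : Finset (Fin n)} {t : ℕ} (hT : T.card ≤ t)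
    {ψ : Reg p (Fin n) × Reg p (Fin n) → ℂ} (hψ : ψ ∈ noisyVectors p (E ∪ T)) :
    adjoinMaxEnt c ψ ∈ Submodule.span ℂ (pauliErrorVectors c E t) := by
  obtain ⟨S, hS⟩ : ∃ S, S = E ∪ T := ⟨_, rfl⟩
  rw [← hS] at hψ
  obtain ⟨χ, hχ⟩ := hψ
  set q : ℂ := ((Real.sqrt p : ℝ) : ℂ)⁻¹
  -- The component of `χ` that shifts Bob's basis vectors by `a` relative to Alice's, expanded
  -- in characters.
  let coef : Reg p S → Reg p S → ℂ := fun a b => (q ^ Sᶜ.card * q ^ c) *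
    (((p : ℂ) ^ Fintype.card S)⁻¹ * ∑ z, χ (z, z + a) * ZMod.stdAddChar (b ⬝ᵥ (-z)))
  have key : adjoinMaxEnt c ψ = ∑ a : Reg p S, ∑ b : Reg p S, coef a b •
      Matrix.vec (pauli (padZero c (extendZero S a, extendZero S b))) := by
    ext ⟨x, y⟩
    let xS : Reg p S := fun i => x (Sum.inl i)
    let yS : Reg p S := fun i => y (Sum.inl i)
    have h1 : ∀ a b : Reg p S,
        Matrix.vec (pauli (padZero c (extendZero S a, extendZero S b))) (x, y) =
        if y = x + Sum.elim (extendZero S a) 0 then (ZMod.stdAddChar (b ⬝ᵥ xS) : ℂ) else 0 := by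
      intro a b
      have h2 : (Sum.elim (extendZero S b) 0 : Reg p (Fin n ⊕ Fin c)) ⬝ᵥ x = b ⬝ᵥ xS := by
        rw [← extendZero_dotProduct S b fun i => x (Sum.inl i)]
        simp [dotProduct]
      rw [← h2]
      rfl
    have h3 : ∀ a : Reg p S, (y = x + Sum.elim (extendZero S a) 0) ↔
        a = yS - xS ∧ (∀ i ∈ Sᶜ, x (Sum.inl i) = y (Sum.inl i)) ∧
          (fun i => x (Sum.inr i)) = fun i => y (Sum.inr i) := by
      intro a
      constructor
      · rintro rfl
        refine ⟨funext fun i => ?_, fun i hi => ?_, funext fun i => ?_⟩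
        · simp [xS, yS, extendZero]
        · simp [extendZero, Finset.mem_compl.1 hi]
        · simp
      · rintro ⟨rfl, h4, h5⟩
        funext i
        rcases i with i | i
        · by_cases hi : i ∈ S
          · simp [extendZero, hi, xS, yS]
          · simp [extendZero, hi, h4 i (Finset.mem_compl.2 hi)]
        · simpa using (congrFun h5 i).symm
    have h6 : ∀ a : Reg p S, ∑ b : Reg p S, coef a b * (ZMod.stdAddChar (b ⬝ᵥ xS) : ℂ) =
        (q ^ Sᶜ.card * q ^ c) * χ (xS, xS + a) := by
      intro a
      rw [← sum_fourier (fun z => χ (z, z + a)) xS, Finset.mul_sum]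
      exact Finset.sum_congr rfl fun b _ => mul_assoc _ _ _
    simp only [Finset.sum_apply, Pi.smul_apply, smul_eq_mul, h1]
    have h7 : ∀ a : Reg p S, (∑ b : Reg p S, coef a b *
        if y = x + Sum.elim (extendZero S a) 0 then (ZMod.stdAddChar (b ⬝ᵥ xS) : ℂ) else 0) =
        if a = yS - xS then
          (if (∀ i ∈ Sᶜ, x (Sum.inl i) = y (Sum.inl i)) ∧
            (fun i => x (Sum.inr i)) = fun i => y (Sum.inr i) then
            (q ^ Sᶜ.card * q ^ c) * χ (xS, xS + a) else 0) else 0 := by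
      intro a
      rw [← ite_and, ← h6]
      simp only [h3 a]
      split_ifs <;> simp
    simp only [h7, Finset.sum_ite_eq', Finset.mem_univ, if_true, add_sub_cancel]
    change ψ (_, _) * maxEnt p (Fin c) (_, _) = _
    rw [hχ, prod_bell, maxEnt_apply, Fintype.card_fin, ite_and]
    split_ifs
    · change χ (xS, yS) * q ^ Sᶜ.card * q ^ c = _
      ring
    · simp
    · simp
    · simp
  rw [key]
  refine Submodule.sum_mem _ fun a _ => Submodule.sum_mem _ fun b _ =>
    Submodule.smul_mem _ _ (Submodule.subset_span ⟨_, ?_, rfl⟩)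
  subst hS
  exact (weightOutside_extendZero_le E T a b).trans hT

/-- The range of a noisy state with perfect pairs adjoined is spanned by Pauli errors. -/
lemma col_withPerfectPairs_mem_span {E : Finset (Fin n)} {t : ℕ} {σ : PairOp p (Fin n)}
    (hσ : IsNoisyState E t σ) (v : Reg p (Fin n ⊕ Fin c) × Reg p (Fin n ⊕ Fin c)) :
    (fun u => withPerfectPairs c σ u v) ∈ Submodule.span ℂ (pauliErrorVectors c E t) := by
  have h1 := hσ.2.2 (Pi.single (fun i => v.1 (Sum.inl i), fun i => v.2 (Sum.inl i)) 1)
  rw [Matrix.mulVec_single_one] at h1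
  have h2 : Submodule.span ℂ (⋃ T ∈ {T : Finset (Fin n) | T.card ≤ t}, noisyVectors p (E ∪ T)) ≤
      (Submodule.span ℂ (pauliErrorVectors c E t)).comap (adjoinMaxEnt c) := by
    rw [Submodule.span_le]
    intro ψ hψ
    obtain ⟨T, hT, hψ⟩ := Set.mem_iUnion₂.1 hψ
    exact adjoinMaxEnt_mem_span c hT hψ
  have h3 := Submodule.smul_mem _ (star (maxEnt p (Fin c)
    (fun i => v.1 (Sum.inr i), fun i => v.2 (Sum.inr i)))) (Submodule.mem_comap.1 (h2 h1))
  convert h3 using 1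
  ext u
  simp only [withPerfectPairs, Matrix.of_apply, maxEntOp, Matrix.vecMulVec_apply, Pi.star_apply,
    Pi.smul_apply, smul_eq_mul, adjoinMaxEnt, LinearMap.coe_mk, AddHom.coe_mk, Matrix.col_apply]
  ring

lemma trace_withPerfectPairs (σ : PairOp p (Fin n)) :
    (withPerfectPairs c σ).trace = σ.trace := by
  let e : Reg p (Fin n ⊕ Fin c) × Reg p (Fin n ⊕ Fin c) ≃
      (Reg p (Fin n) × Reg p (Fin n)) × (Reg p (Fin c) × Reg p (Fin c)) :=
    (Equiv.prodCongr (Equiv.sumArrowEquivProdArrow _ _ _)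
      (Equiv.sumArrowEquivProdArrow _ _ _)).trans (Equiv.prodProdProdComm _ _ _ _)
  change ∑ u, σ (e u).1 (e u).1 * maxEntOp p (Fin c) (e u).2 (e u).2 = _
  rw [e.sum_comp fun w => σ w.1 w.1 * maxEntOp p (Fin c) w.2 w.2, Fintype.sum_prod_type]
  change ∑ u, ∑ w, σ u u * maxEntOp p (Fin c) w w = _
  rw [← Finset.sum_mul_sum]
  change σ.trace * (maxEntOp p (Fin c)).trace = _
  rw [trace_maxEntOp, mul_one]

end Noise

/-! ### The final state of the protocol -/

section FinalState

/-- A self-adjoint matrix whose columns are multiples of `η` is a multiple of `η η†`. -/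
lemma exists_eq_smul_vecMulVec {m : Type} {M : Matrix m m ℂ} (hM : M.conjTranspose = M)
    {η : m → ℂ} (hη : ∀ v, ∃ a : ℂ, ∀ u, M u v = a * η u) :
    ∃ l : ℂ, M = l • Matrix.vecMulVec η (star η) := by
  choose a ha using hη
  by_cases h0 : η = 0
  · refine ⟨0, ?_⟩
    ext u v
    simp [ha, h0]
  · obtain ⟨w, hw⟩ := Function.ne_iff.1 h0
    rw [Pi.zero_apply] at hw
    refine ⟨star (a w) / η w, ?_⟩
    ext u v
    have h1 : star (M v w) = M w v := congrFun (congrFun hM w) v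
    rw [ha, ha, star_mul'] at h1
    rw [ha, Matrix.smul_apply, Matrix.vecMulVec_apply, smul_eq_mul, Pi.star_apply]
    field_simp
    linear_combination -(η u) * h1

variable {p : ℕ} [Fact p.Prime] {n c k r : ℕ}

lemma trace_discardAncillas
    (M : Matrix ((Reg p (Fin k) × Reg p (Fin r)) × (Reg p (Fin k) × Reg p (Fin r)))
      ((Reg p (Fin k) × Reg p (Fin r)) × (Reg p (Fin k) × Reg p (Fin r))) ℂ) :
    (discardAncillas M).trace = M.trace := by
  simp only [Matrix.trace, Matrix.diag_apply, discardAncillas, Matrix.of_apply,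
    Fintype.sum_prod_type]
  refine Finset.sum_congr rfl fun x _ => ?_
  rw [Finset.sum_comm]

/-- Discarding the ancillas of the decoded state leaves the maximally entangled state. -/
lemma discardAncillas_vec (l : ℂ) (j : Reg p (Fin r)) :
    discardAncillas (l • Matrix.vecMulVec
      (Matrix.vec ((1 : Matrix (Reg p (Fin k)) (Reg p (Fin k)) ℂ) ⊗ₖ Matrix.single j j (1 : ℂ)))
      (star (Matrix.vec ((1 : Matrix (Reg p (Fin k)) (Reg p (Fin k)) ℂ) ⊗ₖ
        Matrix.single j j (1 : ℂ))))) = (l * (p : ℂ) ^ k) • maxEntOp p (Fin k) := by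
  have hp : (p : ℂ) ≠ 0 := Nat.cast_ne_zero.2 (Fact.out : p.Prime).ne_zero
  ext ⟨x, y⟩ ⟨x', y'⟩
  simp only [discardAncillas, Matrix.of_apply, Matrix.smul_apply, Matrix.vecMulVec_apply,
    Pi.star_apply, Matrix.vec, Matrix.kroneckerMap_apply, Matrix.one_apply, Matrix.single_apply,
    maxEntOp_apply, Fintype.card_fin, smul_eq_mul]
  by_cases hx : x = y
  · by_cases hy : x' = y'
    · simp [hx, hy, ite_and, hp]
    · simp [hy, Ne.symm hy]
  · simp [hx, Ne.symm hx]

variable {h : Fin r → Symp p (Fin n ⊕ Fin c)} {φ : Fin r → ℂ}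
  {U : (Fin r → ZMod p) → Matrix (Reg p (Fin n ⊕ Fin c)) (Reg p (Fin k) × Reg p (Fin r)) ℂ}
  {dec : Finset (Fin n) → (Fin r → ZMod p) → Symp p (Fin n ⊕ Fin c)}
  (hiso : ∀ i j, sympForm (h i) (h j) = 0) (hφ : ∀ i, bobObservable h φ i ^ p = 1)

include hiso hφ

lemma transpose_aliceOp (a : Fin r → ZMod p) :
    (aliceOp h φ U a).transpose = syndromeProj (bobObservable h φ) (-a) * U (-a) := by
  have h1 : ((U (-a)).map star).conjTranspose.transpose = U (-a) := by
    ext x y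
    simp
  have h2 : ((syndromeProj (bobObservable h φ) (-a)).map star).transpose =
      (syndromeProj (bobObservable h φ) (-a)).conjTranspose := rfl
  rw [aliceOp, Matrix.transpose_mul, h1, syndromeProj_aliceObservable, h2,
    conjTranspose_syndromeProj (commute_bobObservable hiso) hφ
      (conjTranspose_bobObservable_mul_self hφ)]

lemma conjTranspose_bobOp_mul_self (hU : ∀ s, U s * (U s).conjTranspose = 1)
    (E : Finset (Fin n)) (a b : Fin r → ZMod p) :
    (bobOp h φ U dec E a b).conjTranspose * bobOp h φ U dec E a b =
      syndromeProj (bobObservable h φ) b := by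
  have h1 := conjTranspose_syndromeProj (commute_bobObservable hiso) hφ
    (conjTranspose_bobObservable_mul_self hφ) b
  have h2 := mul_eq_one_comm.1 (conjTranspose_pauli_mul_self (dec E (a + b)))
  calc _ = (syndromeProj (bobObservable h φ) b).conjTranspose *
        (pauli (dec E (a + b)) * (U (-a) * (U (-a)).conjTranspose) *
          (pauli (dec E (a + b))).conjTranspose) * syndromeProj (bobObservable h φ) b := by
        simp only [bobOp, Matrix.conjTranspose_mul, Matrix.conjTranspose_conjTranspose,
          Matrix.mul_assoc]
    _ = _ := by
      rw [hU, Matrix.mul_one, h2, Matrix.mul_one, h1,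
        syndromeProj_mul_self (commute_bobObservable hiso) hφ]

lemma conjTranspose_aliceOp_mul_self (hU : ∀ s, U s * (U s).conjTranspose = 1)
    (a : Fin r → ZMod p) :
    (aliceOp h φ U a).conjTranspose * aliceOp h φ U a =
      syndromeProj (aliceObservable h φ) a := by
  have h1 := conjTranspose_syndromeProj (commute_bobObservable hiso) hφ
    (conjTranspose_bobObservable_mul_self hφ) (-a)
  have h2 := syndromeProj_mul_self (commute_bobObservable hiso) hφ (-a)
  have h3 := transpose_aliceOp hiso hφ (U := U) a
  have h4 : (aliceOp h φ U a).conjTranspose.transpose =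
      (aliceOp h φ U a).transpose.conjTranspose := rfl
  apply Matrix.transpose_injective
  rw [Matrix.transpose_mul, syndromeProj_aliceObservable, h4, h3]
  change _ = (syndromeProj (bobObservable h φ) (-a)).conjTranspose
  rw [h1, Matrix.conjTranspose_mul, h1, Matrix.mul_assoc, ← Matrix.mul_assoc (U (-a)), hU,
    Matrix.one_mul, h2]

/-- The protocol preserves the trace, because both measurements are complete. -/
lemma trace_run (hU : ∀ s, U s * (U s).conjTranspose = 1) (E : Finset (Fin n))
    (ρ : PairOp p (Fin n ⊕ Fin c)) :
    (∑ a : Fin r → ZMod p, ∑ b : Fin r → ZMod p, discardAncillas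
      ((aliceOp h φ U a ⊗ₖ bobOp h φ U dec E a b) * ρ *
        (aliceOp h φ U a ⊗ₖ bobOp h φ U dec E a b).conjTranspose)).trace = ρ.trace := by
  have h1 : ∀ a b, (discardAncillas
      ((aliceOp h φ U a ⊗ₖ bobOp h φ U dec E a b) * ρ *
        (aliceOp h φ U a ⊗ₖ bobOp h φ U dec E a b).conjTranspose)).trace =
      ((syndromeProj (aliceObservable h φ) a ⊗ₖ syndromeProj (bobObservable h φ) b) *
        ρ).trace := by
    intro a b
    rw [trace_discardAncillas, Matrix.trace_mul_comm, ← Matrix.mul_assoc,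
      Matrix.conjTranspose_kronecker, ← Matrix.mul_kronecker_mul,
      conjTranspose_aliceOp_mul_self hiso hφ hU, conjTranspose_bobOp_mul_self hiso hφ hU]
  simp only [Matrix.trace_sum, h1]
  have h2 : ∑ a, ∑ b, syndromeProj (aliceObservable h φ) a ⊗ₖ
      syndromeProj (bobObservable h φ) b = 1 := by
    trans (∑ a, syndromeProj (aliceObservable h φ) a) ⊗ₖ ∑ b, syndromeProj (bobObservable h φ) b
    · ext u v
      simp only [Matrix.sum_apply, Matrix.kroneckerMap_apply, Finset.sum_mul_sum]
    · rw [sum_syndromeProj, sum_syndromeProj, Matrix.one_kronecker_one]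
  simp only [← Matrix.trace_sum, ← Matrix.sum_mul]
  rw [h2, Matrix.one_mul]

/-- After the outcomes `a` and `b`, a Pauli error with which the decoder agrees up to a stabilizer
leaves a multiple of the encoded maximally entangled state, decoded. -/
lemma exists_kronecker_mulVec_vec {E : Finset (Fin n)} {a b : Fin r → ZMod p}
    {v : Symp p (Fin n ⊕ Fin c)}
    (hv : v - dec E (syndrome h v) ∈ Submodule.span (ZMod p) (Set.range h)) :
    ∃ l : ℂ, (aliceOp h φ U a ⊗ₖ bobOp h φ U dec E a b).mulVec (Matrix.vec (pauli v)) =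
      l • Matrix.vec
        ((U (-a)).conjTranspose * syndromeProj (bobObservable h φ) (-a) * U (-a)) := by
  have h1 : bobOp h φ U dec E a b * pauli v * (aliceOp h φ U a).transpose =
      (U (-a)).conjTranspose * ((pauli (dec E (a + b))).conjTranspose *
        (syndromeProj (bobObservable h φ) b *
          (pauli v * syndromeProj (bobObservable h φ) (-a)))) * U (-a) := by
    rw [transpose_aliceOp hiso hφ, bobOp]
    simp only [Matrix.mul_assoc]
  rw [Matrix.kronecker_mulVec_vec, h1, syndromeProj_mul_pauli_mul hiso hφ]
  split_ifs with hb
  · have hs : a + b = syndrome h v := by rw [hb]; abel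
    obtain ⟨l, hl⟩ := exists_pauli_mul_syndromeProj hiso hφ hv (-a)
    refine ⟨ZMod.stdAddChar ((dec E (syndrome h v)).2 ⬝ᵥ (dec E (syndrome h v)).1 -
      (dec E (syndrome h v)).2 ⬝ᵥ v.1) * l, ?_⟩
    rw [hs, ← Matrix.mul_assoc (pauli _).conjTranspose, conjTranspose_pauli_mul, Matrix.smul_mul,
      hl, smul_smul, Matrix.mul_smul, Matrix.smul_mul, Matrix.vec_smul]
  · exact ⟨0, by simp⟩

end FinalState

/-- Any decoder that recovers every correctable Pauli error up to a stabilizer makes the protocol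
work: superpositions and mixtures of such errors are handled by linearity, since the decoded state
does not depend on the error but for a scalar. -/
lemma corrects_breedingProtocol {p : ℕ} [Fact p.Prime] {n c k r : ℕ}
    {h : Fin r → Symp p (Fin n ⊕ Fin c)} {φ : Fin r → ℂ}
    {U : (Fin r → ZMod p) → Matrix (Reg p (Fin n ⊕ Fin c)) (Reg p (Fin k) × Reg p (Fin r)) ℂ}
    {dec : Finset (Fin n) → (Fin r → ZMod p) → Symp p (Fin n ⊕ Fin c)}
    (hiso : ∀ i j, sympForm (h i) (h j) = 0) (hφ : ∀ i, bobObservable h φ i ^ p = 1)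
    (hli : LinearIndependent (ZMod p) h) (hcard : r + k = Fintype.card (Fin n ⊕ Fin c))
    (hU : ∀ s, IsEncoder (bobObservable h φ) s (U s)) {t e : ℕ}
    (hdec : ∀ E : Finset (Fin n), E.card ≤ e → ∀ v, weightOutside E v ≤ t →
      padZero c v - dec E (syndrome h (padZero c v)) ∈
        Submodule.span (ZMod p) (Set.range h)) :
    (breedingProtocol h φ U dec).Corrects t e := by
  intro E σ hE hσ
  change (∑ a : Fin r → ZMod p, ∑ b : Fin r → ZMod p, discardAncillas
      ((aliceOp h φ U a ⊗ₖ bobOp h φ U dec E a b) * withPerfectPairs c σ *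
        (aliceOp h φ U a ⊗ₖ bobOp h φ U dec E a b).conjTranspose)) = maxEntOp p (Fin k)
  have hρ := conjTranspose_withPerfectPairs c hσ.1.1
  have h1 : ∀ a b, ∃ l : ℂ, discardAncillas
      ((aliceOp h φ U a ⊗ₖ bobOp h φ U dec E a b) * withPerfectPairs c σ *
        (aliceOp h φ U a ⊗ₖ bobOp h φ U dec E a b).conjTranspose) = l • maxEntOp p (Fin k) := by
    intro a b
    obtain ⟨j, hj⟩ := exists_conjTranspose_mul_syndromeProj_mul hiso hφ hli hcard (hU (-a))
    set K := aliceOp h φ U a ⊗ₖ bobOp h φ U dec E a b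
    set η := Matrix.vec ((1 : Matrix (Reg p (Fin k)) (Reg p (Fin k)) ℂ) ⊗ₖ
      Matrix.single j j (1 : ℂ)) with hη
    have h2 : Submodule.span ℂ (pauliErrorVectors c E t) ≤
        (Submodule.span ℂ {η}).comap K.mulVecLin := by
      rw [Submodule.span_le]
      rintro _ ⟨v, hv, rfl⟩
      obtain ⟨l, hl⟩ := exists_kronecker_mulVec_vec hiso hφ (U := U) (a := a) (b := b)
        (hdec E hE v hv)
      rw [hj] at hl
      exact Submodule.mem_span_singleton.2 ⟨l, hl.symm⟩
    have h3 : ∀ v, ∃ l : ℂ, ∀ u, (K * withPerfectPairs c σ) u v = l * η u := by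
      intro v
      obtain ⟨l, hl⟩ := Submodule.mem_span_singleton.1
        (h2 (col_withPerfectPairs_mem_span c hσ v))
      exact ⟨l, fun u => (congrFun hl u).symm⟩
    have h4 : ∀ v, ∃ l : ℂ, ∀ u,
        (K * withPerfectPairs c σ * K.conjTranspose) u v = l * η u := by
      intro v
      choose l hl using h3
      refine ⟨∑ w, l w * K.conjTranspose w v, fun u => ?_⟩
      rw [Matrix.mul_apply, Finset.sum_mul]
      refine Finset.sum_congr rfl fun w _ => ?_
      rw [hl]
      ring
    have h5 : (K * withPerfectPairs c σ * K.conjTranspose).conjTranspose =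
        K * withPerfectPairs c σ * K.conjTranspose := by
      rw [Matrix.conjTranspose_mul, Matrix.conjTranspose_mul, Matrix.conjTranspose_conjTranspose,
        hρ, Matrix.mul_assoc]
    obtain ⟨l, hl⟩ := exists_eq_smul_vecMulVec h5 h4
    exact ⟨_, by rw [hl, hη, discardAncillas_vec]⟩
  have htr := trace_run hiso hφ (dec := dec) (fun s => (hU s).2.1) E (withPerfectPairs c σ)
  rw [trace_withPerfectPairs, hσ.2.1] at htr
  choose l hl using h1
  simp only [hl, ← Finset.sum_smul] at htr ⊢
  rw [Matrix.trace_smul, trace_maxEntOp, smul_eq_mul, mul_one] at htr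
  rw [htr, one_smul]

end Breeding

theorem mainTheorem1 {p : ℕ} [Fact p.Prime] {n k c r : ℕ} {d : ℕ∞}
    (D : Submodule (ZMod p) (Breeding.Symp p (Fin n)))
    (hD : Breeding.IsEACode D k d c)
    (C : Submodule (ZMod p) (Breeding.Symp p (Fin n ⊕ Fin c)))
    (hC : Breeding.IsStabilizerCode C k)
    (hCD : Breeding.puncture C = D)
    (h : Module.Basis (Fin r) (ZMod p) C) :
    ∃ dec : Finset (Fin n) → (Fin r → ZMod p) → Breeding.Symp p (Fin n ⊕ Fin c),
      ∀ (φ : Fin r → ℂ)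
        (_hφ : ∀ i, Breeding.bobObservable (fun i => (h i : Breeding.Symp p (Fin n ⊕ Fin c)))
          φ i ^ p = 1)
        (U : (Fin r → ZMod p) → Matrix (Breeding.Reg p (Fin n ⊕ Fin c))
          (Breeding.Reg p (Fin k) × Breeding.Reg p (Fin r)) ℂ)
        (_hU : ∀ s, Breeding.IsEncoder
          (Breeding.bobObservable (fun i => (h i : Breeding.Symp p (Fin n ⊕ Fin c))) φ) s (U s)),
        (∀ t e : ℕ, ((2 * t + e : ℕ) : ℕ∞) < d →
          (Breeding.breedingProtocol
            (fun i => (h i : Breeding.Symp p (Fin n ⊕ Fin c))) φ U dec).Corrects t e) ∧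
        (Breeding.breedingProtocol
          (fun i => (h i : Breeding.Symp p (Fin n ⊕ Fin c))) φ U dec).produced = k ∧
        (Breeding.breedingProtocol
          (fun i => (h i : Breeding.Symp p (Fin n ⊕ Fin c))) φ U dec).netYield
          = (k : ℤ) - (c : ℤ) := by
  subst hCD
  obtain ⟨dec, hdec⟩ := Breeding.exists_decoder
    fun i => (h i : Breeding.Symp p (Fin n ⊕ Fin c))
  have hspan : Submodule.span (ZMod p)
      (Set.range fun i => (h i : Breeding.Symp p (Fin n ⊕ Fin c))) = C := by
    have h1 := congrArg (Submodule.map C.subtype) h.span_eq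
    rwa [Submodule.map_span, ← Set.range_comp, Submodule.map_top, Submodule.range_subtype] at h1
  have hcard : r + k = Fintype.card (Fin n ⊕ Fin c) := by
    rw [← hC.2, Module.finrank_eq_card_basis h, Fintype.card_fin]
  refine ⟨dec, fun φ hφ U hU => ⟨fun t e hte => ?_, rfl, rfl⟩⟩
  refine Breeding.corrects_breedingProtocol (fun i j => hC.1 (h j).2 _ (h i).2) hφ
    (h.linearIndependent.map' C.subtype C.ker_subtype) hcard hU fun E hE v hv => ?_
  obtain ⟨u, hu, hsyn, hle⟩ := hdec E v
  rw [hu, hspan]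
  refine Breeding.padZero_sub_mem hD hC hspan (lt_of_le_of_lt ?_ hte) hsyn (hle.trans hv) hv
  exact_mod_cast Nat.add_le_add_left hE _
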